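/- Let $d\ge 7$ be an odd integer and let $\varepsilon>0$. There is a constant $C_\varepsilon=C(d,\varepsilon)>0$ such that the following holds for every finite field $\mathbb F_q$ with $q=\underline p^{\,l}$ elements, where $\underline p\equiv 3 \pmod 4$ is a prime and $l(d-1)$ is not a multiple of $4$, and for every non-trivial additive character $\chi$ of $\mathbb F_q$. Let $S=\{(\underline x,x_d)\in\mathbb F_q^{d-1}\times\mathbb F_q : x_d=\underline x\cdot\underline x\}$ be the paraboloid in $\mathbb F_q^d$. For $f:S\to\mathbb C$ and $m\in\mathbb F_q^d$ put $(f\,d\sigma)^\vee(m)=\frac1{|S|}\sum_{x\in S}\chi(x\cdot m)f(x)$, and for $1\le p,r<\infty$ put $$\|f\|_{L^p(S,d\sigma)}=\Big(\frac1{|S|}\sum_{x\in S}|f(x)|^p\Big)^{1/p},\qquad \|g\|_{L^r(\mathbb F_q^d,dm)}=\Big(\sum_{m\in\mathbb F_q^d}|g(m)|^r\Big)^{1/r},$$ with the maximum of the absolute value when the exponent is $\infty$. For $1\le p,r\le\infty$ let $R^*(p\to r)$ be the smallest constant such that $$\|(f\,d\sigma)^\vee\|_{L^r(\mathbb F_q^d,dm)}\le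 R^*(p\to r)\,\|f\|_{L^p(S,d\sigma)}\qquad\text{for all } f:S\to\mathbb C.$$ Then $$R^*(p\to 4)\le C_\varepsilon\, q^{\varepsilon}\qquad\text{for all } \frac{4d}{3d-2}\le p\le\infty,$$ and $$R^*(2\to r)\le C_\varepsilon\, q^{\varepsilon}\qquad\text{for all } \frac{2d^2}{d^2-2d+2}\le r\le\infty.$$ -/

import Mathlib

open scoped ENNReal

noncomputable section

namespace Extension

/-- The `d`-dimensional space `F^d = F^(d-1) × F` (for `d ≥ 1`), whose points are written
`(x', x_d)` with `x' ∈ F^(d-1)` and `x_d ∈ F`. -/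
abbrev Space (F : Type*) (d : ℕ) : Type _ := (Fin (d - 1) → F) × F

/-- The usual dot product on `F^d`. -/
def dot {F : Type*} [Field F] {d : ℕ} (x m : Space F d) : F :=
  x.1 ⬝ᵥ m.1 + x.2 * m.2

open Classical in
/-- The paraboloid `{(x', x_d) : x_d = x' · x'}` in `F^d`. -/
def paraboloid (F : Type*) [Field F] [Fintype F] (d : ℕ) : Finset (Space F d) :=
  Finset.univ.filter fun x => x.2 = x.1 ⬝ᵥ x.1

/-- The `L^r` norm with respect to the counting measure, for `1 ≤ r ≤ ∞`. -/
def countNorm {α : Type*} [Fintype α] (r : ℝ≥0∞) (g : α → ℂ) : ℝ :=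
  if r = ∞ then ⨆ m, ‖g m‖ else (∑ m, ‖g m‖ ^ r.toReal) ^ (1 / r.toReal)

/-- The `L^p` norm with respect to the normalized counting measure, for `1 ≤ p ≤ ∞`. -/
def avgNorm {α : Type*} [Fintype α] (p : ℝ≥0∞) (f : α → ℂ) : ℝ :=
  if p = ∞ then ⨆ x, ‖f x‖
  else ((Fintype.card α : ℝ)⁻¹ * ∑ x, ‖f x‖ ^ p.toReal) ^ (1 / p.toReal)

/-- The extension operator `(f dσ)^∨ (m) = |S|⁻¹ ∑_{x ∈ S} χ(x · m) f(x)`, where `S` is a finite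
subset of `F^d`. -/
def extension {F : Type*} [Field F] {d : ℕ} (χ : AddChar F ℂ) (S : Finset (Space F d))
    (f : S → ℂ) (m : Space F d) : ℂ :=
  (S.card : ℂ)⁻¹ * ∑ x : S, χ (dot x.1 m) * f x

/-- The constants `C ≥ 0` for which `‖(f dσ)^∨‖_{L^r(F^d, dm)} ≤ C ‖f‖_{L^p(S, dσ)}` holds for all
functions `f` on the paraboloid `S`. -/
def admissible {F : Type*} [Field F] [Fintype F] (χ : AddChar F ℂ) (d : ℕ) (p r : ℝ≥0∞) : Set ℝ :=
  {C | 0 ≤ C ∧ ∀ f : paraboloid F d → ℂ,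
    countNorm r (extension χ (paraboloid F d) f) ≤ C * avgNorm p f}

/-- `R^*(p → r)` for the paraboloid in `F^d`: the smallest admissible constant
(see `isLeast_extensionConstant`). -/
def extensionConstant {F : Type*} [Field F] [Fintype F] (χ : AddChar F ℂ) (d : ℕ)
    (p r : ℝ≥0∞) : ℝ :=
  sInf (admissible χ d p r)

theorem norm_le_card_mul_avgNorm {α : Type*} [Fintype α] {p : ℝ≥0∞} (hp : 1 ≤ p) (f : α → ℂ)
    (x : α) : ‖f x‖ ≤ Fintype.card α * avgNorm p f := by
  have hc : (1 : ℝ) ≤ Fintype.card α := by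
    have : 0 < Fintype.card α := Fintype.card_pos_iff.mpr ⟨x⟩
    exact_mod_cast this
  unfold avgNorm
  split_ifs with h
  · have h1 : ‖f x‖ ≤ ⨆ x, ‖f x‖ := le_ciSup (f := fun x => ‖f x‖) (Set.finite_range _).bddAbove x
    have h0 : 0 ≤ ‖f x‖ := norm_nonneg _
    nlinarith
  · have hp1 : 1 ≤ p.toReal := by
      rw [← ENNReal.toReal_one]
      exact (ENNReal.toReal_le_toReal (by simp) h).mpr hp
    have hp0 : 0 < p.toReal := by linarith
    have h1 : ‖f x‖ ^ p.toReal ≤ ∑ x, ‖f x‖ ^ p.toReal :=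
      Finset.single_le_sum (f := fun x => ‖f x‖ ^ p.toReal)
        (fun i _ => by positivity) (Finset.mem_univ x)
    have hs : 0 ≤ ∑ x, ‖f x‖ ^ p.toReal := by positivity
    rw [Real.mul_rpow (by positivity) hs]
    have h2 : ‖f x‖ ≤ (∑ x, ‖f x‖ ^ p.toReal) ^ (1 / p.toReal) := by
      calc ‖f x‖ = (‖f x‖ ^ p.toReal) ^ (1 / p.toReal) := by
            rw [← Real.rpow_mul (norm_nonneg _), mul_one_div_cancel hp0.ne', Real.rpow_one]
        _ ≤ _ := Real.rpow_le_rpow (by positivity) h1 (by positivity)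
    have h3 : (Fintype.card α : ℝ)⁻¹ ≤ ((Fintype.card α : ℝ)⁻¹) ^ (1 / p.toReal) := by
      conv_lhs => rw [← Real.rpow_one ((Fintype.card α : ℝ)⁻¹)]
      apply Real.rpow_le_rpow_of_exponent_ge (by positivity) (inv_le_one_of_one_le₀ hc)
      rw [div_le_one hp0]; exact hp1
    have h4 : 1 ≤ Fintype.card α * ((Fintype.card α : ℝ)⁻¹) ^ (1 / p.toReal) := by
      calc (1 : ℝ) = Fintype.card α * (Fintype.card α : ℝ)⁻¹ := by
            rw [mul_inv_cancel₀ (by positivity)]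
        _ ≤ _ := by gcongr
    rw [← mul_assoc]
    have h0 : 0 ≤ ‖f x‖ := norm_nonneg _
    nlinarith

theorem countNorm_le {α : Type*} [Fintype α] [Nonempty α] {r : ℝ≥0∞} (hr : 1 ≤ r) (g : α → ℂ)
    {M : ℝ} (h : ∀ x, ‖g x‖ ≤ M) : countNorm r g ≤ Fintype.card α * M := by
  have hc : (1 : ℝ) ≤ Fintype.card α := by
    exact_mod_cast (Fintype.card_pos : 0 < Fintype.card α)
  have hM : 0 ≤ M := (norm_nonneg _).trans (h (Classical.arbitrary α))
  unfold countNorm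
  split_ifs with hr'
  · exact (ciSup_le h).trans (by nlinarith)
  · have hr1 : 1 ≤ r.toReal := by
      rw [← ENNReal.toReal_one]
      exact (ENNReal.toReal_le_toReal (by simp) hr').mpr hr
    have hr0 : 0 < r.toReal := by linarith
    calc (∑ m, ‖g m‖ ^ r.toReal) ^ (1 / r.toReal)
        ≤ (∑ _m : α, M ^ r.toReal) ^ (1 / r.toReal) := by
          gcongr with m _
          exact h m
      _ = (Fintype.card α : ℝ) ^ (1 / r.toReal) * M := by
          rw [Finset.sum_const, nsmul_eq_mul, Finset.card_univ,
            Real.mul_rpow (by positivity) (by positivity), ← Real.rpow_mul hM,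
            mul_one_div_cancel hr0.ne', Real.rpow_one]
      _ ≤ Fintype.card α * M := by
          gcongr
          conv_rhs => rw [← Real.rpow_one (Fintype.card α : ℝ)]
          apply Real.rpow_le_rpow_of_exponent_le hc
          rw [div_le_one hr0]; exact hr1

theorem isLeast_extensionConstant {F : Type*} [Field F] [Fintype F] (χ : AddChar F ℂ) (d : ℕ)
    {p r : ℝ≥0∞} (hp : 1 ≤ p) (hr : 1 ≤ r) :
    IsLeast (admissible χ d p r) (extensionConstant χ d p r) := by
  have hbdd : BddBelow (admissible χ d p r) := ⟨0, fun C hC => hC.1⟩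
  have hclosed : IsClosed (admissible χ d p r) := by
    have : admissible χ d p r = Set.Ici 0 ∩ ⋂ f : paraboloid F d → ℂ,
        {C : ℝ | countNorm r (extension χ (paraboloid F d) f) ≤ C * avgNorm p f} := by
      ext C; simp [admissible]
    rw [this]
    exact isClosed_Ici.inter (isClosed_iInter fun f =>
      isClosed_le continuous_const (by fun_prop))
  have hne : (admissible χ d p r).Nonempty := by
    refine ⟨Fintype.card (Space F d) * Fintype.card (paraboloid F d), by positivity, fun f => ?_⟩
    rw [mul_assoc]
    refine countNorm_le hr _ fun m => ?_
    have hS : 0 < Fintype.card (paraboloid F d) :=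
      Fintype.card_pos_iff.mpr ⟨⟨0, by simp [paraboloid]⟩⟩
    rw [extension, norm_mul, norm_inv, Complex.norm_natCast]
    have hcard : ((paraboloid F d).card : ℝ) = Fintype.card (paraboloid F d) := by simp
    rw [hcard, inv_mul_le_iff₀ (by exact_mod_cast hS)]
    refine (norm_sum_le _ _).trans ?_
    calc ∑ x : paraboloid F d, ‖χ (dot x.1 m) * f x‖
        ≤ ∑ _x : paraboloid F d, (Fintype.card (paraboloid F d) : ℝ) * avgNorm p f := by
          refine Finset.sum_le_sum fun x _ => ?_
          rw [norm_mul, AddChar.norm_apply, one_mul]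
          exact norm_le_card_mul_avgNorm hp f x
      _ = _ := by rw [Finset.sum_const, nsmul_eq_mul, Finset.card_univ]
  exact ⟨hclosed.csInf_mem hne hbdd, fun C hC => csInf_le hbdd hC⟩

end Extension

end

/-! Write d = n + 1 with n = 2k. The hypotheses force l and k to be odd, so q ≡ 3 mod 4 and -1 is
not a square. The one-dimensional quadratic Gauss sum then squares to -q, and the n-dimensional one
is -q^k times a phase for every nonzero leading coefficient. This negative sign drives the whole
argument.

The L^4 bound reduces to the additive energy Λ(E) of a set E lifted to the paraboloid, which is
governed by right-angled triples in E. With one vertex fixed, the second moment of the deviation of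
the orthogonality count from its mean is expanded in characters. Because of the sign, the
off-diagonal terms are at most q^k, whereas the opposite sign would allow terms of order q^(k+1)
(`re_sum_units_le`, `sum_sq_orthCount_le`). Together with the trivial bound |E|^3 this gives Λ(E) ≤
3 q^(1-2/d) |E|^(3-2/d) (`card_energyQuads_le`). A dyadic decomposition (`norm_le_of_restricted`)
turns the resulting restricted estimate into a strong one at a logarithmic cost, which q^ε absorbs.

The L^2 → L^r bound is dual to an L^2 restriction bound for functions supported on a set G.
Following Mockenhaupt and Tao, the square is expanded with the Gauss kernel; an inversion of
variables turns the interaction with each horizontal slice into a `liftTransform` of that slice, to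
which the L^4 bound applies. This is efficient for small G and Plancherel for large G; their
crossing at |G| = q^(d²/(2(d-1))) determines r. -/

noncomputable section

namespace Extension

/-! ### Quadratic Gauss sums when -1 is not a square. -/

section Gauss

theorem addChar_sum {ι F : Type*} [Field F] (χ : AddChar F ℂ) (s : Finset ι) (f : ι → F) :
    χ (∑ i ∈ s, f i) = ∏ i ∈ s, χ (f i) := by
  classical
  induction s using Finset.induction_on with
  | empty => simp
  | insert a s ha ih => rw [Finset.sum_insert ha, Finset.prod_insert ha, AddChar.map_add_eq_mul, ih]


theorem two_ne_zero_of_not_isSquare {F : Type*} [Field F] (hs : ¬ IsSquare (-1 : F)) : (2 : F) ≠ 0 := by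
  intro h
  apply hs
  refine ⟨1, ?_⟩
  linear_combination -h

variable {F : Type*} [Field F] [Fintype F] {n : ℕ} {χ : AddChar F ℂ}

open Classical in
theorem sum_addChar_mul (hχ : χ ≠ 1) (b : F) :
    ∑ x : F, χ (x * b) = if b = 0 then (Fintype.card F : ℂ) else 0 := by
  have := AddChar.sum_mulShift b (AddChar.IsPrimitive.of_ne_one hχ)
  rw [this]
  push_cast
  rfl

/-- Sums of products over `Fin n → F` factor. -/
theorem sum_addChar_sum (f : Fin n → F → F) :
    ∑ x : Fin n → F, χ (∑ i, f i (x i)) = ∏ i, ∑ t, χ (f i t) := by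
  classical
  rw [Finset.prod_univ_sum, Fintype.piFinset_univ]
  simp [addChar_sum]

open Classical in
theorem sum_addChar_dotProduct (hχ : χ ≠ 1) (w : Fin n → F) :
    ∑ x : Fin n → F, χ (x ⬝ᵥ w) = if w = 0 then (Fintype.card F : ℂ) ^ n else 0 := by
  have := sum_addChar_sum (χ := χ) (fun i t => t * w i)
  rw [show ∑ x : Fin n → F, χ (x ⬝ᵥ w) = _ from this]
  simp_rw [sum_addChar_mul hχ]
  split_ifs with h
  · simp [h]
  · obtain ⟨i, hi⟩ := Function.ne_iff.mp h
    exact Finset.prod_eq_zero (Finset.mem_univ i) (by simpa using hi)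

/-- Substituting x = z + y makes the phase linear in y, and summing over y forces z = 0. -/
theorem quadSum_mul_quadSum_neg (hχ : χ ≠ 1) (hs : ¬ IsSquare (-1 : F)) {u : F} (hu : u ≠ 0) :
    (∑ x, χ (u * x ^ 2)) * ∑ x, χ (-u * x ^ 2) = Fintype.card F := by
  classical
  have h2 := two_ne_zero_of_not_isSquare hs
  rw [Finset.sum_mul_sum, Finset.sum_comm]
  have h1 : ∀ y : F, ∑ x, χ (u * x ^ 2) * χ (-u * y ^ 2)
      = ∑ z, χ (u * z ^ 2) * χ (y * (2 * u * z)) := by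
    intro y
    rw [← Equiv.sum_comp (Equiv.addRight y)]
    refine Finset.sum_congr rfl fun z _ => ?_
    rw [← AddChar.map_add_eq_mul, ← AddChar.map_add_eq_mul]
    congr 1
    simp only [Equiv.coe_addRight]
    ring
  simp_rw [h1]
  rw [Finset.sum_comm]
  simp_rw [← Finset.mul_sum, sum_addChar_mul hχ]
  simp [h2, hu]

/-- An element t has 1 + η(t) square roots, η being the quadratic character. Here η is odd, so the η
parts cancel between u and -u, and what remains is a complete sum of a nontrivial character. -/
theorem quadSum_add_quadSum_neg (hχ : χ ≠ 1) (hs : ¬ IsSquare (-1 : F)) {u : F} (hu : u ≠ 0) :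
    (∑ x, χ (u * x ^ 2)) + ∑ x, χ (-u * x ^ 2) = 0 := by
  classical
  have h2 := two_ne_zero_of_not_isSquare hs
  have hc : ringChar F ≠ 2 := by
    intro h
    apply h2
    have := ringChar.Nat.cast_ringChar (R := F)
    rw [h] at this
    exact_mod_cast this
  have key : ∀ v : F, ∑ x, χ (v * x ^ 2) = ∑ t, ((quadraticChar F t : ℂ) + 1) * χ (v * t) := by
    intro v
    rw [← Finset.sum_fiberwise (s := Finset.univ) (g := fun x : F => x ^ 2)]
    refine Finset.sum_congr rfl fun t _ => ?_
    rw [Finset.sum_congr rfl (g := fun _ => χ (v * t))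
      (fun x hx => by rw [(Finset.mem_filter.mp hx).2])]
    rw [Finset.sum_const, nsmul_eq_mul]
    congr 1
    have := quadraticChar_card_sqrts hc t
    have h3 : ((Finset.univ.filter fun x : F => x ^ 2 = t).card : ℤ) = quadraticChar F t + 1 := by
      rw [← this]
      congr 2
      ext x
      simp
    exact_mod_cast congrArg (Int.cast : ℤ → ℂ) h3
  rw [key, key, ← Equiv.sum_comp (Equiv.neg F) (fun t => _ * χ (-u * t)), ← Finset.sum_add_distrib]
  have hm : quadraticChar F (-1) = -1 := quadraticChar_neg_one_iff_not_isSquare.mpr hs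
  have h4 : ∀ t : F, (quadraticChar F (-t) : ℂ) = -quadraticChar F t := by
    intro t
    rw [show -t = (-1) * t by ring, map_mul, hm]
    push_cast
    ring
  have h5 := sum_addChar_mul hχ u
  rw [if_neg hu] at h5
  calc _ = ∑ t, 2 * χ (t * u) := by
        refine Finset.sum_congr rfl fun t _ => ?_
        simp only [Equiv.neg_apply, h4]
        rw [show -u * -t = t * u by ring, mul_comm u t]
        ring
    _ = 0 := by rw [← Finset.mul_sum, h5, mul_zero]

theorem quadSum_sq (hχ : χ ≠ 1) (hs : ¬ IsSquare (-1 : F)) {u : F} (hu : u ≠ 0) :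
    (∑ x, χ (u * x ^ 2)) ^ 2 = -Fintype.card F := by
  have h1 := quadSum_mul_quadSum_neg hχ hs hu
  have h2 := quadSum_add_quadSum_neg hχ hs hu
  linear_combination (∑ x, χ (u * x ^ 2)) * h2 - h1

/-- Completing the square. -/
theorem sum_addChar_quadratic (hs : ¬ IsSquare (-1 : F)) {u : F} (hu : u ≠ 0) (w : F) :
    ∑ x, χ (u * x ^ 2 + x * w) = (∑ x, χ (u * x ^ 2)) * χ (-(w ^ 2 / (4 * u))) := by
  have h2 := two_ne_zero_of_not_isSquare hs
  have h4 : (4 : F) ≠ 0 := by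
    rw [show (4 : F) = 2 * 2 by norm_num]
    exact mul_ne_zero h2 h2
  rw [Finset.sum_mul, ← Equiv.sum_comp (Equiv.addRight (w / (2 * u))) (fun x => χ (u * x ^ 2) * _)]
  refine Finset.sum_congr rfl fun x _ => ?_
  rw [← AddChar.map_add_eq_mul]
  congr 1
  simp only [Equiv.coe_addRight]
  field_simp
  ring

/-- The quadratic Gauss sum attached to `x ⬝ᵥ x` in dimension `2k`, `k` odd, when `-1` is not a
square. -/
theorem sum_addChar_quadratic_dotProduct {k : ℕ} (hk : Odd k) (hn : n = 2 * k) (hχ : χ ≠ 1)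
    (hs : ¬ IsSquare (-1 : F)) {u : F} (hu : u ≠ 0) (w : Fin n → F) :
    ∑ x : Fin n → F, χ (u * (x ⬝ᵥ x) + x ⬝ᵥ w)
      = -(Fintype.card F : ℂ) ^ k * χ (-((w ⬝ᵥ w) / (4 * u))) := by
  have h := sum_addChar_sum (χ := χ) (fun i t => u * t ^ 2 + t * w i)
  have h1 : ∀ x : Fin n → F, u * (x ⬝ᵥ x) + x ⬝ᵥ w = ∑ i, (u * x i ^ 2 + x i * w i) := by
    intro x
    simp only [dotProduct, Finset.mul_sum, Finset.sum_add_distrib]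
    congr 1
    exact Finset.sum_congr rfl fun i _ => by ring
  simp_rw [h1, h, sum_addChar_quadratic hs hu, Finset.prod_mul_distrib, ← addChar_sum]
  have hp : (∑ x, χ (u * x ^ 2)) ^ n = -(Fintype.card F : ℂ) ^ k := by
    rw [hn, pow_mul, quadSum_sq hχ hs hu, hk.neg_pow]
  rw [Finset.prod_const, Finset.card_univ, Fintype.card_fin, hp]
  congr 2
  rw [Finset.sum_neg_distrib, ← Finset.sum_div]
  congr 2
  exact Finset.sum_congr rfl fun i _ => by ring

end Gauss

/-! ### Second moment of the orthogonality count. -/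

section Variance

variable {F : Type*} [Field F] [Fintype F] {n : ℕ} {χ : AddChar F ℂ}

open Classical in
theorem sum_units_addChar_mul (hχ : χ ≠ 1) (b : F) :
    ∑ s : Fˣ, χ (s * b) = (if b = 0 then (Fintype.card F : ℂ) else 0) - 1 := by
  rw [← sum_addChar_mul hχ b, ← Finset.add_sum_erase _ _ (Finset.mem_univ (0 : F))]
  have h : (Finset.univ.erase (0 : F)) = Finset.univ.map ⟨Units.val, Units.val_injective⟩ := by
    ext x
    simp only [Finset.mem_erase, Finset.mem_univ, and_true, Finset.mem_map, true_and,
      Function.Embedding.coeFn_mk]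
    exact ⟨fun hx => ⟨Units.mk0 x hx, rfl⟩, fun ⟨y, hy⟩ => hy ▸ y.ne_zero⟩
  rw [h, Finset.sum_map]
  simp

open Classical in
/-- The number of `a ∈ A` for which the segments from `c` to `a` and from `0` to `c` are
orthogonal. -/
def orthCount (A : Finset (Fin n → F)) (c : Fin n → F) : ℕ :=
  (A.filter fun a => (a - c) ⬝ᵥ c = 0).card

open Classical in
theorem sum_units_eq_orthCount (hχ : χ ≠ 1) (A : Finset (Fin n → F)) (c : Fin n → F) :
    ∑ s : Fˣ, ∑ a ∈ A, χ (s * ((a - c) ⬝ᵥ c))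
      = ((Fintype.card F * orthCount A c - A.card : ℝ) : ℂ) := by
  rw [Finset.sum_comm]
  simp_rw [sum_units_addChar_mul hχ]
  rw [Finset.sum_sub_distrib, ← Finset.sum_filter, Finset.sum_const, Finset.sum_const, orthCount]
  push_cast
  simp only [nsmul_eq_mul, mul_one]
  rw [mul_comm]

open Classical in
-- For ρ = 1 the phase is linear in c, and orthogonality leaves only a = b. For ρ ≠ 1 it is
-- quadratic in c, and the Gauss sum followed by the sum over s gives -q^k (q·1[z = 0] - 1). The
-- large term is negative and is dropped, leaving q^k. Only this one-sided bound holds, which is why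
-- real parts appear.
theorem re_sum_units_le {k : ℕ} (hk : Odd k) (hn : n = 2 * k) (hχ : χ ≠ 1)
    (hs : ¬ IsSquare (-1 : F)) (a b : Fin n → F) (ρ : Fˣ) :
    (∑ s : Fˣ, ∑ c : Fin n → F, χ (s * ((a - c) ⬝ᵥ c) - (ρ * s : Fˣ) * ((b - c) ⬝ᵥ c))).re
      ≤ (if ρ = 1 then (if a = b then (Fintype.card F : ℝ) ^ (n + 1) else 0) else 0)
        + (Fintype.card F : ℝ) ^ k := by
  set q := Fintype.card F
  have hq : (0 : ℝ) < q := by exact_mod_cast (Fintype.card_pos : 0 < q)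
  by_cases hρ : ρ = 1
  · subst hρ
    have h1 : ∀ s : Fˣ, ∑ c : Fin n → F, χ (s * ((a - c) ⬝ᵥ c) - (1 * s : Fˣ) * ((b - c) ⬝ᵥ c))
        = if a = b then (q : ℂ) ^ n else 0 := by
      intro s
      have h2 := sum_addChar_dotProduct hχ ((s : F) • (a - b))
      have h3 : ((s : F) • (a - b) = 0) ↔ a = b := by
        rw [smul_eq_zero, sub_eq_zero]
        simp
      simp only [h3] at h2
      rw [← h2]
      refine Finset.sum_congr rfl fun c _ => ?_
      congr 1
      rw [dotProduct_smul, dotProduct_sub, sub_dotProduct, sub_dotProduct, dotProduct_comm c a,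
        dotProduct_comm c b, smul_eq_mul, one_mul]
      ring
    simp_rw [h1]
    rw [Finset.sum_const, Finset.card_univ, nsmul_eq_mul]
    by_cases hab : a = b
    · simp only [hab, if_true]
      have h4 : ((Fintype.card Fˣ : ℂ) * (q : ℂ) ^ n).re = (Fintype.card Fˣ : ℝ) * (q : ℝ) ^ n := by
        norm_cast
      rw [h4]
      have h5 : (Fintype.card Fˣ : ℝ) ≤ q := by
        exact_mod_cast Fintype.card_le_of_injective _ (Units.val_injective (α := F))
      rw [pow_succ']
      have : 0 < (q : ℝ) ^ k := by positivity
      have : (Fintype.card Fˣ : ℝ) * (q : ℝ) ^ n ≤ q * (q : ℝ) ^ n := by gcongr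
      linarith
    · simp only [hab, if_false, mul_zero, Complex.zero_re, if_true, zero_add]
      positivity
  · have hρ' : (ρ : F) - 1 ≠ 0 := by
      rw [sub_ne_zero]
      exact fun h => hρ (Units.ext h)
    have h4 : (4 : F) ≠ 0 := by
      rw [show (4 : F) = 2 * 2 by norm_num]
      exact mul_ne_zero (two_ne_zero_of_not_isSquare hs) (two_ne_zero_of_not_isSquare hs)
    -- The phase left by the Gauss sum is linear in s, so z does not depend on s and the sum over s
    -- is again a complete character sum minus its term at 0.
    set z : F := -(((a - (ρ : F) • b) ⬝ᵥ (a - (ρ : F) • b)) / (4 * ((ρ : F) - 1)))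
    have h1 : ∀ s : Fˣ, ∑ c : Fin n → F, χ (s * ((a - c) ⬝ᵥ c) - (ρ * s : Fˣ) * ((b - c) ⬝ᵥ c))
        = -(q : ℂ) ^ k * χ (s * z) := by
      intro s
      have hu : (s : F) * (ρ - 1) ≠ 0 := mul_ne_zero s.ne_zero hρ'
      have h2 := sum_addChar_quadratic_dotProduct hk hn hχ hs hu ((s : F) • (a - (ρ : F) • b))
      have h3 : (s : F) * z = -((((s : F) • (a - (ρ : F) • b)) ⬝ᵥ ((s : F) • (a - (ρ : F) • b)))
          / (4 * (s * (ρ - 1)))) := by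
        rw [smul_dotProduct, dotProduct_smul, smul_eq_mul, smul_eq_mul]
        have := s.ne_zero
        simp only [z]
        field_simp
      rw [h3, ← h2]
      refine Finset.sum_congr rfl fun c _ => ?_
      congr 1
      rw [dotProduct_smul, dotProduct_sub, dotProduct_smul, sub_dotProduct, sub_dotProduct,
        dotProduct_comm c a, dotProduct_comm c b, smul_eq_mul, smul_eq_mul, Units.val_mul]
      ring
    simp_rw [h1]
    rw [← Finset.mul_sum, sum_units_addChar_mul hχ, if_neg hρ, zero_add]
    have h5 : (-(q : ℂ) ^ k * ((if z = 0 then (q : ℂ) else 0) - 1)).re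
        = -(q : ℝ) ^ k * ((if z = 0 then (q : ℝ) else 0) - 1) := by
      split_ifs <;> norm_cast
    rw [h5]
    have h6 : (0 : ℝ) ≤ if z = 0 then (q : ℝ) else 0 := by split_ifs <;> positivity
    have h7 : 0 ≤ (q : ℝ) ^ k := by positivity
    nlinarith

theorem sum_sq_orthCount_le {k : ℕ} (hk : Odd k) (hn : n = 2 * k) (hχ : χ ≠ 1)
    (hs : ¬ IsSquare (-1 : F)) (A : Finset (Fin n → F)) :
    ∑ c, ((Fintype.card F : ℝ) * orthCount A c - A.card) ^ 2
      ≤ (Fintype.card F : ℝ) ^ (n + 1) * A.card + (Fintype.card F : ℝ) ^ (k + 1) * A.card ^ 2 := by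
  classical
  set q := Fintype.card F
  have hq : (0 : ℝ) < q := by exact_mod_cast (Fintype.card_pos : 0 < q)
  have h1 : ∀ c, (((q : ℝ) * orthCount A c - A.card) ^ 2 : ℂ)
      = ∑ ρ : Fˣ, ∑ a ∈ A, ∑ b ∈ A, ∑ s : Fˣ,
        χ (s * ((a - c) ⬝ᵥ c) - (ρ * s : Fˣ) * ((b - c) ⬝ᵥ c)) := by
    intro c
    -- The character sum is real, so its square can be written as the sum times its conjugate, which
    -- produces differences of phases.
    have h2 := sum_units_eq_orthCount hχ A c
    have h3 : (starRingEnd ℂ) (∑ s : Fˣ, ∑ a ∈ A, χ (s * ((a - c) ⬝ᵥ c)))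
        = ∑ s : Fˣ, ∑ a ∈ A, χ (s * ((a - c) ⬝ᵥ c)) := by
      rw [h2, Complex.conj_ofReal]
    have h4 : (((q : ℝ) * orthCount A c - A.card) ^ 2 : ℂ)
        = (∑ s : Fˣ, ∑ a ∈ A, χ (s * ((a - c) ⬝ᵥ c)))
        * (starRingEnd ℂ) (∑ s : Fˣ, ∑ a ∈ A, χ (s * ((a - c) ⬝ᵥ c))) := by
      rw [h3, h2]
      push_cast
      ring
    rw [h4, map_sum, Finset.sum_mul_sum]
    have h5 : ∀ s : Fˣ, ∑ t : Fˣ, (∑ a ∈ A, χ (s * ((a - c) ⬝ᵥ c)))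
        * (starRingEnd ℂ) (∑ a ∈ A, χ (t * ((a - c) ⬝ᵥ c)))
        = ∑ ρ : Fˣ, ∑ a ∈ A, ∑ b ∈ A, χ (s * ((a - c) ⬝ᵥ c) - (ρ * s : Fˣ) * ((b - c) ⬝ᵥ c)) := by
      intro s
      -- The second frequency is written as t = ρ s, so that s becomes a common dilation that can be
      -- summed last.
      rw [← Equiv.sum_comp (Equiv.mulRight s)]
      refine Finset.sum_congr rfl fun ρ _ => ?_
      rw [map_sum, Finset.sum_mul_sum]
      refine Finset.sum_congr rfl fun a _ => Finset.sum_congr rfl fun b _ => ?_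
      rw [← AddChar.map_neg_eq_conj, ← AddChar.map_add_eq_mul, ← sub_eq_add_neg]
      rfl
    simp_rw [h5]
    rw [Finset.sum_comm]
    refine Finset.sum_congr rfl fun ρ _ => ?_
    rw [Finset.sum_comm]
    refine Finset.sum_congr rfl fun a _ => ?_
    rw [Finset.sum_comm]
  have h2 : ((∑ c, ((q : ℝ) * orthCount A c - A.card) ^ 2 : ℝ) : ℂ)
      = ∑ ρ : Fˣ, ∑ a ∈ A, ∑ b ∈ A, ∑ s : Fˣ, ∑ c,
        χ (s * ((a - c) ⬝ᵥ c) - (ρ * s : Fˣ) * ((b - c) ⬝ᵥ c)) := by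
    push_cast
    push_cast at h1
    simp_rw [h1]
    rw [Finset.sum_comm]
    refine Finset.sum_congr rfl fun ρ _ => ?_
    rw [Finset.sum_comm]
    refine Finset.sum_congr rfl fun a _ => ?_
    rw [Finset.sum_comm]
    refine Finset.sum_congr rfl fun b _ => ?_
    rw [Finset.sum_comm]
  have h3 := congrArg Complex.re h2
  rw [Complex.ofReal_re] at h3
  rw [h3]
  simp only [Complex.re_sum]
  calc _ ≤ ∑ ρ : Fˣ, ∑ a ∈ A, ∑ b ∈ A,
        ((if ρ = 1 then (if a = b then (q : ℝ) ^ (n + 1) else 0) else 0) + (q : ℝ) ^ k) := by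
        refine Finset.sum_le_sum fun ρ _ => Finset.sum_le_sum fun a _ =>
          Finset.sum_le_sum fun b _ => ?_
        have := re_sum_units_le hk hn hχ hs a b ρ
        simpa only [Complex.re_sum] using this
    _ = (q : ℝ) ^ (n + 1) * A.card + Fintype.card Fˣ * ((q : ℝ) ^ k * A.card ^ 2) := by
        simp only [Finset.sum_add_distrib]
        congr 1
        · simp only [Finset.sum_ite_irrel, Finset.sum_const_zero, Finset.sum_ite_eq',
            Finset.mem_univ, if_true]
          rw [Finset.sum_congr rfl (g := fun _ => (q : ℝ) ^ (n + 1))]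
          · rw [Finset.sum_const, nsmul_eq_mul, mul_comm]
          · intro a ha
            rw [Finset.sum_ite_eq, if_pos ha]
        · simp only [Finset.sum_const, nsmul_eq_mul, Finset.card_univ]
          ring
    _ ≤ _ := by
        have h5 : (Fintype.card Fˣ : ℝ) ≤ q := by
          exact_mod_cast Fintype.card_le_of_injective _ (Units.val_injective (α := F))
        rw [pow_succ' _ k, mul_assoc (q : ℝ)]
        gcongr

end Variance

/-! ### Additive energy on the paraboloid. -/

section Energy

variable {F : Type*} [Field F] [Fintype F] {n : ℕ} {χ : AddChar F ℂ}

/-- Cauchy–Schwarz over c ∈ A, after which the sum of squares is enlarged to all c. -/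
theorem sq_sum_orthCount_le {k : ℕ} (hk : Odd k) (hn : n = 2 * k) (hχ : χ ≠ 1)
    (hs : ¬ IsSquare (-1 : F)) (A : Finset (Fin n → F)) :
    ((Fintype.card F : ℝ) * ∑ c ∈ A, (orthCount A c : ℝ) - A.card ^ 2) ^ 2
      ≤ (Fintype.card F : ℝ) ^ (n + 1) * A.card ^ 2
        + (Fintype.card F : ℝ) ^ (k + 1) * A.card ^ 3 := by
  have h1 : (Fintype.card F : ℝ) * ∑ c ∈ A, (orthCount A c : ℝ) - A.card ^ 2
      = ∑ c ∈ A, ((Fintype.card F : ℝ) * orthCount A c - A.card) := by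
    rw [Finset.sum_sub_distrib, Finset.mul_sum, Finset.sum_const, nsmul_eq_mul, sq]
  rw [h1]
  have h2 := sq_sum_le_card_mul_sum_sq (s := A)
    (f := fun c => (Fintype.card F : ℝ) * orthCount A c - A.card)
  have h3 := sum_sq_orthCount_le hk hn hχ hs A
  have h4 : ∑ c ∈ A, ((Fintype.card F : ℝ) * orthCount A c - A.card) ^ 2
      ≤ ∑ c, ((Fintype.card F : ℝ) * orthCount A c - A.card) ^ 2 :=
    Finset.sum_le_sum_of_subset_of_nonneg (Finset.subset_univ _) fun _ _ _ => sq_nonneg _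
  calc _ ≤ (A.card : ℝ) * _ := h2
    _ ≤ A.card * ((Fintype.card F : ℝ) ^ (n + 1) * A.card
        + (Fintype.card F : ℝ) ^ (k + 1) * A.card ^ 2) := by gcongr; exact h4.trans h3
    _ = _ := by ring

open Classical in
/-- The quadruples `((a, b), (c, e))` in `E` whose lifts to the paraboloid satisfy
`a + b = c + e`. -/
def energyQuads (E : Finset (Fin n → F)) :
    Finset (((Fin n → F) × (Fin n → F)) × ((Fin n → F) × (Fin n → F))) :=
  ((E ×ˢ E) ×ˢ (E ×ˢ E)).filter fun x =>
    x.1.1 + x.1.2 = x.2.1 + x.2.2 ∧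
      x.1.1 ⬝ᵥ x.1.1 + x.1.2 ⬝ᵥ x.1.2 = x.2.1 ⬝ᵥ x.2.1 + x.2.2 ⬝ᵥ x.2.2

theorem card_energyQuads_le_cube {F : Type*} [Field F] (E : Finset (Fin n → F)) :
    (energyQuads E).card ≤ E.card ^ 3 := by
  classical
  have : (energyQuads E).card ≤ (E ×ˢ E ×ˢ E).card := by
    refine Finset.card_le_card_of_injOn (fun x => (x.1.1, x.1.2, x.2.1)) ?_ ?_
    · rintro ⟨⟨a, b⟩, ⟨c, e⟩⟩ hx
      simp only [energyQuads, Finset.coe_filter, Finset.mem_product, Set.mem_ofPred_eq] at hx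
      simp [hx]
    · rintro ⟨⟨a, b⟩, ⟨c, e⟩⟩ hx ⟨⟨a', b'⟩, ⟨c', e'⟩⟩ hx' h
      simp only [energyQuads, Finset.coe_filter, Finset.mem_product, Set.mem_ofPred_eq] at hx hx'
      simp only [Prod.mk.injEq] at h ⊢
      obtain ⟨rfl, rfl, rfl⟩ := h
      exact ⟨⟨rfl, rfl⟩, rfl, add_left_cancel (hx.2.1.symm.trans hx'.2.1)⟩
  refine this.trans (le_of_eq ?_)
  rw [Finset.card_product, Finset.card_product]
  ring

/-- Eliminating e = a + b - c turns the quadratic equation into 2 (a - c)·(c - b) = 0, a right angle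
at c. Translating b to the origin makes this an `orthCount` for the set E - b. -/
theorem card_energyQuads_le_sum {F : Type*} [Field F] (hs : ¬ IsSquare (-1 : F)) (E : Finset (Fin n → F)) :
    ∃ A : (Fin n → F) → Finset (Fin n → F), (∀ b, (A b).card = E.card) ∧
      (energyQuads E).card ≤ ∑ b ∈ E, ∑ c ∈ A b, orthCount (A b) c := by
  classical
  refine ⟨fun b => E.map (Equiv.subRight b).toEmbedding, fun b => Finset.card_map _, ?_⟩
  have h1 : ∀ b, ∑ c ∈ E.map (Equiv.subRight b).toEmbedding,
      orthCount (E.map (Equiv.subRight b).toEmbedding) c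
      = ∑ c ∈ E, (E.filter fun a => (a - c) ⬝ᵥ (c - b) = 0).card := by
    intro b
    rw [Finset.sum_map]
    refine Finset.sum_congr rfl fun c _ => ?_
    rw [orthCount, Finset.filter_map, Finset.card_map]
    congr 1
    ext a
    simp
  simp_rw [h1]
  calc (energyQuads E).card
      ≤ (E.sigma fun b => E.sigma fun c => E.filter fun a => (a - c) ⬝ᵥ (c - b) = 0).card := by
        refine Finset.card_le_card_of_injOn (fun x => ⟨x.1.2, x.2.1, x.1.1⟩) ?_ ?_
        · rintro ⟨⟨a, b⟩, ⟨c, e⟩⟩ hx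
          simp only [energyQuads, Finset.coe_filter, Finset.mem_product, Set.mem_ofPred_eq] at hx
          simp only [Finset.coe_sigma, Set.mem_sigma_iff, Finset.mem_coe, Finset.mem_filter]
          refine ⟨hx.1.1.2, hx.1.2.1, hx.1.1.1, ?_⟩
          obtain ⟨he, hq⟩ := hx.2
          have he' : e = a + b - c := by rw [he]; abel
          subst he'
          have h3 : (2 : F) * ((a - c) ⬝ᵥ (c - b)) = 0 := by
            simp only [sub_dotProduct, dotProduct_sub, add_dotProduct, dotProduct_add] at hq ⊢
            rw [dotProduct_comm b a, dotProduct_comm c a, dotProduct_comm c b] at hq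
            rw [dotProduct_comm c b]
            linear_combination hq
          exact (mul_eq_zero.mp h3).resolve_left (two_ne_zero_of_not_isSquare hs)
        · rintro ⟨⟨a, b⟩, ⟨c, e⟩⟩ hx ⟨⟨a', b'⟩, ⟨c', e'⟩⟩ hx' h
          simp only [energyQuads, Finset.coe_filter, Finset.mem_product, Set.mem_ofPred_eq] at hx hx'
          simp only [Sigma.mk.injEq, heq_eq_eq] at h
          obtain ⟨rfl, rfl, rfl⟩ := h
          obtain rfl := add_left_cancel (hx.2.1.symm.trans hx'.2.1)
          rfl
    _ = _ := by simp only [Finset.card_sigma]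

theorem card_energyQuads_le_sqrt {k : ℕ} (hk : Odd k) (hn : n = 2 * k) (hχ : χ ≠ 1)
    (hs : ¬ IsSquare (-1 : F)) (E : Finset (Fin n → F)) :
    (Fintype.card F : ℝ) * (energyQuads E).card ≤ E.card ^ 3
      + E.card * √((Fintype.card F : ℝ) ^ (n + 1) * E.card ^ 2
        + (Fintype.card F : ℝ) ^ (k + 1) * E.card ^ 3) := by
  obtain ⟨A, hA, hle⟩ := card_energyQuads_le_sum hs E
  set R := √((Fintype.card F : ℝ) ^ (n + 1) * E.card ^ 2
        + (Fintype.card F : ℝ) ^ (k + 1) * E.card ^ 3)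
  have h1 : ∀ b, (Fintype.card F : ℝ) * ∑ c ∈ A b, (orthCount (A b) c : ℝ)
      ≤ E.card ^ 2 + R := by
    intro b
    have := Real.le_sqrt_of_sq_le (sq_sum_orthCount_le hk hn hχ hs (A b))
    rw [hA] at this
    linarith
  calc _ ≤ (Fintype.card F : ℝ) * ∑ b ∈ E, ∑ c ∈ A b, (orthCount (A b) c : ℝ) := by
        gcongr
        exact_mod_cast hle
    _ = ∑ b ∈ E, (Fintype.card F : ℝ) * ∑ c ∈ A b, (orthCount (A b) c : ℝ) := Finset.mul_sum _ _ _
    _ ≤ ∑ b ∈ E, ((E.card : ℝ) ^ 2 + R) := Finset.sum_le_sum fun b _ => h1 b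
    _ = _ := by rw [Finset.sum_const, nsmul_eq_mul]; ring

/-- The target, apart from the factor 3, equals |E|^3 at |E| = q^((d-2)/2) and |E|^3 / q at |E| =
q^(d-1). Below the first size the trivial bound suffices; above it each of the three terms of
`card_energyQuads_le_sqrt` is compared with the target through exponents of q. -/
theorem card_energyQuads_le {k : ℕ} (hk : Odd k) (hk3 : 3 ≤ k) (hn : n = 2 * k) (hχ : χ ≠ 1)
    (hs : ¬ IsSquare (-1 : F)) {d : ℝ} (hd : d = n + 1) (E : Finset (Fin n → F)) :
    ((energyQuads E).card : ℝ)
      ≤ 3 * ((Fintype.card F : ℝ) ^ (1 - 2 / d) * (E.card : ℝ) ^ (3 - 2 / d)) := by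
  rcases E.eq_empty_or_nonempty with rfl | hE
  · have : (energyQuads (∅ : Finset (Fin n → F))).card = 0 := by simp [energyQuads]
    rw [this]
    push_cast
    positivity
  have hN1 : (1 : ℝ) ≤ E.card := by exact_mod_cast hE.card_pos
  have hNq : (E.card : ℝ) ≤ (Fintype.card F : ℝ) ^ (n : ℝ) := by
    rw [Real.rpow_natCast]
    have := Finset.card_le_univ E
    simp only [Fintype.card_fun, Fintype.card_fin] at this
    exact_mod_cast this
  have hq1 : (1 : ℝ) < Fintype.card F := by exact_mod_cast Fintype.one_lt_card
  have hen := card_energyQuads_le_sqrt hk hn hχ hs E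
  have htriv : ((energyQuads E).card : ℝ) ≤ (E.card : ℝ) ^ 3 := by
    exact_mod_cast card_energyQuads_le_cube E
  set q : ℝ := (Fintype.card F : ℝ)
  set N : ℝ := (E.card : ℝ)
  set Q : ℝ := ((energyQuads E).card : ℝ)
  have hq0 : 0 < q := by linarith
  have hk' : (k : ℝ) = (d - 1) / 2 := by
    rw [hd, hn]; push_cast; ring
  have hd7 : 7 ≤ d := by
    have : (3 : ℝ) ≤ k := by exact_mod_cast hk3
    linarith
  obtain ⟨x, hx⟩ : ∃ x : ℝ, N = q ^ x :=
    ⟨Real.logb q N, (Real.rpow_logb hq0 hq1.ne' (by linarith)).symm⟩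
  have hxn : x ≤ d - 1 := by
    rw [hx, Real.rpow_le_rpow_left_iff hq1] at hNq
    linarith
  have hT : q ^ (1 - 2 / d) * N ^ (3 - 2 / d) = q ^ (1 - 2 / d + x * (3 - 2 / d)) := by
    rw [hx, ← Real.rpow_mul hq0.le, ← Real.rpow_add hq0]
  have hNpow : ∀ j : ℕ, N ^ j = q ^ (x * j) := by
    intro j
    rw [hx, ← Real.rpow_natCast, ← Real.rpow_mul hq0.le]
  have hqpow : ∀ j : ℕ, q ^ j = q ^ (j : ℝ) := fun j => (Real.rpow_natCast q j).symm
  rw [hT]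
  set T := q ^ (1 - 2 / d + x * (3 - 2 / d)) with hTdef
  have hT0 : 0 < T := Real.rpow_pos_of_pos hq0 _
  rcases le_total x ((d - 2) / 2) with hc | hc
  · have : N ^ 3 ≤ T := by
      rw [hNpow, hTdef, Real.rpow_le_rpow_left_iff hq1]
      push_cast
      have : x * (2 / d) ≤ (d - 2) / 2 * (2 / d) := by gcongr
      have h2 : (d - 2) / 2 * (2 / d) = 1 - 2 / d := by field_simp
      linarith
    linarith
  · have hA : N ^ 3 ≤ q * T := by
      have : q * T = q ^ (1 + (1 - 2 / d + x * (3 - 2 / d))) := by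
        rw [Real.rpow_add hq0, Real.rpow_one]
      rw [this, hNpow, Real.rpow_le_rpow_left_iff hq1]
      push_cast
      have : x * (2 / d) ≤ (d - 1) * (2 / d) := by gcongr
      have h2 : (d - 1) * (2 / d) = 2 - 2 / d := by field_simp
      linarith
    have hsq : (q * T) ^ 2 = q ^ (2 + 2 * (1 - 2 / d + x * (3 - 2 / d))) := by
      rw [mul_pow, hTdef, ← Real.rpow_natCast q 2, ← Real.rpow_natCast (q ^ _) 2,
        ← Real.rpow_mul hq0.le, ← Real.rpow_add hq0]
      push_cast
      ring_nf
    have hB : N ^ 2 * (q ^ (n + 1) * N ^ 2) ≤ (q * T) ^ 2 := by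
      have : N ^ 2 * (q ^ (n + 1) * N ^ 2) = q ^ (d + x * 4) := by
        rw [hqpow (n + 1), hNpow 2, ← Real.rpow_add hq0, ← Real.rpow_add hq0]
        push_cast
        rw [hd]
        ring_nf
      rw [this, hsq, Real.rpow_le_rpow_left_iff hq1]
      have h1 : 0 ≤ 2 - 4 / d := by
        rw [sub_nonneg, div_le_iff₀ (by linarith)]; linarith
      have h2 : (d - 2) / 2 * (2 - 4 / d) ≤ x * (2 - 4 / d) := by gcongr
      have h3 : (d - 2) / 2 * (2 - 4 / d) = d - 4 + 4 / d := by field_simp; ring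
      have h4 : 2 * (1 - 2 / d + x * (3 - 2 / d)) = 2 - 4 / d + x * 4 + x * (2 - 4 / d) := by ring
      linarith
    have hC : N ^ 2 * (q ^ (k + 1) * N ^ 3) ≤ (q * T) ^ 2 := by
      have : N ^ 2 * (q ^ (k + 1) * N ^ 3) = q ^ ((d - 1) / 2 + 1 + x * 5) := by
        rw [hqpow (k + 1), hNpow 2, hNpow 3, ← Real.rpow_add hq0, ← Real.rpow_add hq0]
        push_cast
        rw [hk']
        ring_nf
      rw [this, hsq, Real.rpow_le_rpow_left_iff hq1]
      have h1 : 0 ≤ 1 - 4 / d := by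
        rw [sub_nonneg, div_le_iff₀ (by linarith)]; linarith
      have h2 : (d - 2) / 2 * (1 - 4 / d) ≤ x * (1 - 4 / d) := by gcongr
      have h3 : (d - 2) / 2 * (1 - 4 / d) = d / 2 - 3 + 4 / d := by field_simp; ring
      have h4 : 2 * (1 - 2 / d + x * (3 - 2 / d)) = 2 - 4 / d + x * 5 + x * (1 - 4 / d) := by ring
      linarith
    have hR : N * √(q ^ (n + 1) * N ^ 2 + q ^ (k + 1) * N ^ 3) ≤ 2 * (q * T) := by
      have hN0 : 0 ≤ N := by linarith
      rw [← Real.sqrt_sq hN0, ← Real.sqrt_mul (sq_nonneg N), Real.sqrt_sq hN0]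
      apply Real.sqrt_le_iff.mpr
      refine ⟨by positivity, ?_⟩
      rw [mul_add]
      nlinarith [sq_nonneg (q * T)]
    have : q * Q ≤ q * (3 * T) := by linarith
    exact le_of_mul_le_mul_left this hq0

end Energy

/-! ### Fourth moments and the restricted L^4 estimate. -/

section Transform

variable {F : Type*} [Field F] [Fintype F] {n : ℕ} {χ : AddChar F ℂ}

/-- The unnormalized Fourier transform, at `m`, of the function `h` transplanted to the paraboloid
by `y ↦ (y, y ⬝ᵥ y)`. -/
def liftTransform (χ : AddChar F ℂ) (h : (Fin n → F) → ℂ) (m : (Fin n → F) × F) : ℂ :=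
  ∑ y, χ (y ⬝ᵥ m.1 + (y ⬝ᵥ y) * m.2) * h y

open Classical in
theorem sum_addChar_prod (hχ : χ ≠ 1) (v : Fin n → F) (w : F) :
    ∑ m : (Fin n → F) × F, χ (v ⬝ᵥ m.1 + w * m.2)
      = if v = 0 ∧ w = 0 then (Fintype.card F : ℂ) ^ (n + 1) else 0 := by
  rw [Fintype.sum_prod_type]
  simp_rw [AddChar.map_add_eq_mul, ← Finset.mul_sum]
  rw [← Finset.sum_mul]
  have h1 := sum_addChar_dotProduct hχ v
  have h2 := sum_addChar_mul hχ w
  simp_rw [dotProduct_comm v, mul_comm w]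
  rw [h1, h2]
  by_cases hv : v = 0 <;> by_cases hw : w = 0 <;> simp [hv, hw, pow_succ]

/-- Expanding the fourth power and summing over m leaves exactly the energy quadruples, each with a
coefficient of modulus at most 1. -/
theorem sum_norm_liftTransform_pow_four_le (hχ : χ ≠ 1) (E : Finset (Fin n → F))
    (h : (Fin n → F) → ℂ) (h1 : ∀ y ∈ E, ‖h y‖ ≤ 1) (h0 : ∀ y ∉ E, h y = 0) :
    ∑ m, ‖liftTransform χ h m‖ ^ 4 ≤ (Fintype.card F : ℝ) ^ (n + 1) * (energyQuads E).card := by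
  classical
  have hU : ∀ m, liftTransform χ h m = ∑ y ∈ E, χ (y ⬝ᵥ m.1 + (y ⬝ᵥ y) * m.2) * h y := by
    intro m
    rw [liftTransform]
    symm
    exact Finset.sum_subset (Finset.subset_univ _) fun y _ hy => by rw [h0 y hy, mul_zero]
  set c : ((Fin n → F) × (Fin n → F)) × ((Fin n → F) × (Fin n → F)) → ℂ := fun x =>
    (h x.1.1 * h x.1.2) * (starRingEnd ℂ) (h x.2.1 * h x.2.2) with hc
  have h4 : ∀ m, ((‖liftTransform χ h m‖ ^ 4 : ℝ) : ℂ)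
      = ∑ x ∈ (E ×ˢ E) ×ˢ (E ×ˢ E), c x * χ ((x.1.1 + x.1.2 - (x.2.1 + x.2.2)) ⬝ᵥ m.1
        + (x.1.1 ⬝ᵥ x.1.1 + x.1.2 ⬝ᵥ x.1.2 - (x.2.1 ⬝ᵥ x.2.1 + x.2.2 ⬝ᵥ x.2.2)) * m.2) := by
    intro m
    have h5 : liftTransform χ h m ^ 2 = ∑ x ∈ E ×ˢ E, (h x.1 * h x.2) *
          χ ((x.1 + x.2) ⬝ᵥ m.1 + (x.1 ⬝ᵥ x.1 + x.2 ⬝ᵥ x.2) * m.2) := by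
      rw [hU, sq, Finset.sum_mul_sum, Finset.sum_product]
      refine Finset.sum_congr rfl fun a _ => Finset.sum_congr rfl fun b _ => ?_
      have : (a + b) ⬝ᵥ m.1 + (a ⬝ᵥ a + b ⬝ᵥ b) * m.2
          = (a ⬝ᵥ m.1 + (a ⬝ᵥ a) * m.2) + (b ⬝ᵥ m.1 + (b ⬝ᵥ b) * m.2) := by
        rw [add_dotProduct]; ring
      rw [this, AddChar.map_add_eq_mul χ (a ⬝ᵥ m.1 + (a ⬝ᵥ a) * m.2)]
      ring
    have h6 : ((‖liftTransform χ h m‖ ^ 4 : ℝ) : ℂ)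
        = liftTransform χ h m ^ 2 * (starRingEnd ℂ) (liftTransform χ h m ^ 2) := by
      rw [Complex.mul_conj, Complex.normSq_eq_norm_sq, norm_pow]
      push_cast
      ring
    rw [h6, h5, map_sum, Finset.sum_mul_sum, Finset.sum_product (E ×ˢ E) (E ×ˢ E)]
    refine Finset.sum_congr rfl fun a _ => Finset.sum_congr rfl fun b _ => ?_
    rw [map_mul, ← AddChar.map_neg_eq_conj, sub_dotProduct, sub_mul]
    have : ∀ A B C D : F, A - C + (B - D) = (A + B) + -(C + D) := fun A B C D => by ring
    rw [this, AddChar.map_add_eq_mul χ (_ + _) (-_)]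
    simp only [hc]
    ring
  have h5 : ((∑ m : (Fin n → F) × F, ‖liftTransform χ h m‖ ^ 4 : ℝ) : ℂ)
      = ∑ x ∈ energyQuads E, c x * (Fintype.card F : ℂ) ^ (n + 1) := by
    rw [Complex.ofReal_sum]
    simp_rw [h4]
    rw [Finset.sum_comm, energyQuads, Finset.sum_filter]
    refine Finset.sum_congr rfl fun x _ => ?_
    rw [← Finset.mul_sum, sum_addChar_prod hχ]
    simp only [sub_eq_zero]
    split_ifs <;> simp
  have h6 : ∑ m, ‖liftTransform χ h m‖ ^ 4
      = ‖∑ x ∈ energyQuads E, c x * (Fintype.card F : ℂ) ^ (n + 1)‖ := by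
    rw [← h5, Complex.norm_real, Real.norm_of_nonneg]
    positivity
  rw [h6]
  refine (norm_sum_le _ _).trans ?_
  calc _ ≤ ∑ x ∈ energyQuads E, (Fintype.card F : ℝ) ^ (n + 1) := by
        refine Finset.sum_le_sum fun x hx => ?_
        simp only [energyQuads, Finset.mem_filter, Finset.mem_product] at hx
        rw [norm_mul, norm_pow, Complex.norm_natCast]
        have hcx : ‖c x‖ ≤ 1 := by
          simp only [hc, norm_mul, RCLike.norm_conj]
          have := h1 _ hx.1.1.1
          have := h1 _ hx.1.1.2
          have := h1 _ hx.1.2.1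
          have := h1 _ hx.1.2.2
          refine mul_le_one₀ (mul_le_one₀ ?_ ?_ ?_) ?_ (mul_le_one₀ ?_ ?_ ?_) <;>
            first | assumption | positivity
        exact mul_le_of_le_one_left (by positivity) hcx
    _ = _ := by rw [Finset.sum_const, nsmul_eq_mul, mul_comm]

theorem sum_norm_liftTransform_rpow_le {k : ℕ} (hk : Odd k) (hk3 : 3 ≤ k) (hn : n = 2 * k)
    (hχ : χ ≠ 1) (hs : ¬ IsSquare (-1 : F)) {d : ℝ} (hd : d = n + 1) (E : Finset (Fin n → F))
    (h : (Fin n → F) → ℂ) (h1 : ∀ y ∈ E, ‖h y‖ ≤ 1) (h0 : ∀ y ∉ E, h y = 0) :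
    (∑ m, ‖liftTransform χ h m‖ ^ (4 : ℝ)) ^ (1 / 4 : ℝ)
      ≤ 2 * (Fintype.card F : ℝ) ^ (d / 4 + 1 / 4 - 1 / (2 * d))
        * (E.card : ℝ) ^ (3 / 4 - 1 / (2 * d)) := by
  have hq0 : (0 : ℝ) < Fintype.card F := by exact_mod_cast Fintype.card_pos
  have hd0 : 1 ≤ d := by rw [hd]; linarith [(Nat.cast_nonneg n : (0 : ℝ) ≤ n)]
  have hA := sum_norm_liftTransform_pow_four_le hχ E h h1 h0
  have hB := card_energyQuads_le hk hk3 hn hχ hs hd E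
  have hC : ∑ m, ‖liftTransform χ h m‖ ^ (4 : ℝ) = ∑ m, ‖liftTransform χ h m‖ ^ 4 := by
    refine Finset.sum_congr rfl fun m _ => ?_
    exact_mod_cast Real.rpow_natCast _ 4
  rw [hC]
  set q : ℝ := (Fintype.card F : ℝ)
  set R := 2 * q ^ (d / 4 + 1 / 4 - 1 / (2 * d)) * (E.card : ℝ) ^ (3 / 4 - 1 / (2 * d)) with hR
  have hR0 : 0 ≤ R := by positivity
  -- The constant 2 in the bound becomes 2^4 = 16, which leaves room for the 3 of the energy
  -- estimate.
  have hR4 : R ^ (4 : ℝ) = 16 * (q ^ (n + 1) * (q ^ (1 - 2 / d) * (E.card : ℝ) ^ (3 - 2 / d))) := by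
    rw [hR, Real.mul_rpow (by positivity) (by positivity), Real.mul_rpow (by norm_num)
      (by positivity), ← Real.rpow_mul hq0.le, ← Real.rpow_mul (by positivity), ← mul_assoc (q ^ _),
      ← Real.rpow_natCast q (n + 1), ← Real.rpow_add hq0, ← mul_assoc]
    push_cast
    rw [← hd]
    congr 2
    · norm_num
    · congr 1
      field_simp
      ring
    · field_simp
      ring
  rw [show R = (R ^ (4 : ℝ)) ^ (1 / 4 : ℝ) by
    rw [← Real.rpow_mul hR0]; norm_num]
  refine Real.rpow_le_rpow (by positivity) ?_ (by norm_num)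
  rw [hR4]
  refine hA.trans ?_
  have : 0 ≤ q ^ (n + 1) * (q ^ (1 - 2 / d) * (E.card : ℝ) ^ (3 - 2 / d)) := by positivity
  calc _ ≤ q ^ (n + 1) * (3 * (q ^ (1 - 2 / d) * (E.card : ℝ) ^ (3 - 2 / d))) := by gcongr
    _ ≤ _ := by linarith

end Transform

/-! ### From restricted to strong type. -/

section Dyadic

variable {α X : Type*} [Fintype α] [SeminormedAddCommGroup X] [NormedSpace ℂ X]

/-- A linear map which satisfies a restricted strong type estimate satisfies the corresponding
strong type estimate up to a factor logarithmic in the size of the domain. -/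
theorem norm_le_of_restricted (L : (α → ℂ) →ₗ[ℂ] X) {s B : ℝ} (hs0 : 0 < s) (hs1 : s ≤ 1)
    (hB : 0 ≤ B)
    (hL : ∀ (E : Finset α) (h : α → ℂ), (∀ y ∈ E, ‖h y‖ ≤ 1) → (∀ y ∉ E, h y = 0) →
      ‖L h‖ ≤ B * (E.card : ℝ) ^ s)
    {K : ℕ} (hK : Fintype.card α ≤ 2 ^ K) (h : α → ℂ) :
    ‖L h‖ ≤ B * (2 * K + 1) * (∑ y, ‖h y‖ ^ (1 / s)) ^ s := by
  classical
  have hscale : ∀ (E : Finset α) (g : α → ℂ) (t : ℝ), 0 < t → (∀ y ∈ E, ‖g y‖ ≤ t) →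
      (∀ y ∉ E, g y = 0) → ‖L g‖ ≤ t * (B * (E.card : ℝ) ^ s) := by
    intro E g t ht hg hg0
    have h1 := hL E ((t⁻¹ : ℂ) • g) (fun y hy => by
      rw [Pi.smul_apply, norm_smul, norm_inv, Complex.norm_real, Real.norm_of_nonneg ht.le,
        inv_mul_le_one₀ ht]
      exact hg y hy) (fun y hy => by simp [hg0 y hy])
    rw [map_smul, norm_smul, norm_inv, Complex.norm_real, Real.norm_of_nonneg ht.le,
      inv_mul_le_iff₀ ht] at h1
    exact h1
  set P := (∑ y, ‖h y‖ ^ (1 / s)) ^ s with hP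
  have hP0 : 0 ≤ P := by positivity
  -- Chebyshev's inequality: t |E|^s is at most the strong norm P when |h| ≥ t on E.
  have hpt : ∀ (E : Finset α) (t : ℝ), 0 ≤ t → (∀ y ∈ E, t ≤ ‖h y‖) →
      t * (E.card : ℝ) ^ s ≤ P := by
    intro E t ht hE
    have h1 : (t * (E.card : ℝ) ^ s) = (E.card * t ^ (1 / s)) ^ s := by
      rw [Real.mul_rpow (by positivity) (by positivity), ← Real.rpow_mul ht,
        one_div_mul_cancel hs0.ne', Real.rpow_one, mul_comm]
    rw [h1, hP]
    refine Real.rpow_le_rpow (by positivity) ?_ hs0.le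
    calc (E.card : ℝ) * t ^ (1 / s) = ∑ y ∈ E, t ^ (1 / s) := by
          rw [Finset.sum_const, nsmul_eq_mul]
      _ ≤ ∑ y ∈ E, ‖h y‖ ^ (1 / s) := Finset.sum_le_sum fun y hy =>
          Real.rpow_le_rpow ht (hE y hy) (by positivity)
      _ ≤ _ := Finset.sum_le_sum_of_subset_of_nonneg (Finset.subset_univ _)
          fun _ _ _ => by positivity
  rcases eq_or_ne h 0 with rfl | hne
  · rw [map_zero, norm_zero]
    positivity
  obtain ⟨y₀, -⟩ := Function.ne_iff.mp hne
  obtain ⟨y₁, -, hy₁⟩ := Finset.exists_max_image Finset.univ (fun y => ‖h y‖) ⟨y₀, by simp⟩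
  set M := ‖h y₁‖ with hM
  have hM0 : 0 < M := by
    rw [hM, norm_pos_iff]
    intro h0
    apply hne
    ext y
    have := hy₁ y (Finset.mem_univ y)
    rw [hM, h0, norm_zero] at this
    simpa using this
  have hMP : M ≤ P := by
    have := hpt {y₁} M hM0.le (by simp [hM])
    simpa using this
  -- The part of h left after peeling off j dyadic levels below the maximum M. Each level costs at
  -- most 2BP, the 2 being the ratio of its endpoints.
  set rest : ℕ → α → ℂ := fun j y => if ‖h y‖ ≤ M * (1 / 2) ^ j then h y else 0 with hrest
  have hind : ∀ j : ℕ, ‖L h‖ ≤ ‖L (rest j)‖ + j * (2 * (B * P)) := by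
    intro j
    induction j with
    | zero =>
      have : rest 0 = h := by
        ext y
        simp only [hrest, pow_zero, mul_one]
        rw [if_pos (hy₁ y (Finset.mem_univ y))]
      rw [this]
      simp
    | succ j ih =>
      set E : Finset α := Finset.univ.filter fun y =>
        M * (1 / 2) ^ (j + 1) < ‖h y‖ ∧ ‖h y‖ ≤ M * (1 / 2) ^ j with hE
      set g : α → ℂ := fun y => if y ∈ E then h y else 0 with hg
      have hsplit : rest j = g + rest (j + 1) := by
        ext y
        simp only [hrest, hg, hE, Pi.add_apply, Finset.mem_filter, Finset.mem_univ, true_and]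
        have hlt : M * (1 / 2) ^ (j + 1) < M * (1 / 2) ^ j := by
          have : 0 < M * (1 / 2) ^ j := by positivity
          rw [pow_succ]
          linarith
        by_cases h1 : ‖h y‖ ≤ M * (1 / 2) ^ (j + 1)
        · rw [if_pos h1, if_pos (h1.trans hlt.le), if_neg (fun h => absurd h1 (not_le.mpr h.1)),
            zero_add]
        · rw [if_neg h1, add_zero]
          simp only [not_le.mp h1, true_and]
      have h1 : ‖L g‖ ≤ 2 * (B * P) := by
        have h2 := hscale E g (M * (1 / 2) ^ j) (by positivity)
          (fun y hy => by
            simp only [hg, hy, if_true]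
            exact (Finset.mem_filter.mp hy).2.2)
          (fun y hy => by simp [hg, hy])
        have h3 := hpt E (M * (1 / 2) ^ (j + 1)) (by positivity)
          (fun y hy => (Finset.mem_filter.mp hy).2.1.le)
        have h4 : M * (1 / 2) ^ j * (B * (E.card : ℝ) ^ s)
            = 2 * (B * (M * (1 / 2) ^ (j + 1) * (E.card : ℝ) ^ s)) := by
          rw [pow_succ]; ring
        rw [h4] at h2
        refine h2.trans ?_
        gcongr
      have h2 : ‖L (rest j)‖ ≤ ‖L g‖ + ‖L (rest (j + 1))‖ := by
        rw [hsplit, map_add]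
        exact norm_add_le _ _
      push_cast
      linarith
  -- After K levels the values are at most M 2^(-K), which compensates for the size of the whole
  -- domain.
  have hlast : ‖L (rest K)‖ ≤ B * P := by
    have h2 := hscale Finset.univ (rest K) (M * (1 / 2) ^ K) (by positivity)
      (fun y _ => by
        simp only [hrest]
        split_ifs with h1
        · exact h1
        · rw [norm_zero]; positivity)
      (fun y hy => absurd (Finset.mem_univ y) hy)
    refine h2.trans ?_
    have h3 : ((Finset.univ : Finset α).card : ℝ) ^ s ≤ 2 ^ K := by
      have h5 : ((Finset.univ : Finset α).card : ℝ) ≤ 2 ^ K := by exact_mod_cast hK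
      calc ((Finset.univ : Finset α).card : ℝ) ^ s ≤ ((2 : ℝ) ^ K) ^ s := by gcongr
        _ ≤ ((2 : ℝ) ^ K) ^ (1 : ℝ) :=
            Real.rpow_le_rpow_of_exponent_le (one_le_pow₀ (by norm_num)) hs1
        _ = _ := Real.rpow_one _
    calc M * (1 / 2) ^ K * (B * ((Finset.univ : Finset α).card : ℝ) ^ s)
        ≤ M * (1 / 2) ^ K * (B * 2 ^ K) := by gcongr
      _ = B * M * ((1 / 2) ^ K * 2 ^ K) := by ring
      _ = B * M := by rw [← mul_pow]; norm_num
      _ ≤ _ := by gcongr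
  have := hind K
  calc ‖L h‖ ≤ B * P + K * (2 * (B * P)) := by linarith
    _ = _ := by ring

/-- Hölder against the constant function 1. -/
theorem sum_le_card_rpow_mul {ι : Type*} (s : Finset ι) (f : ι → ℝ) (hf : ∀ i ∈ s, 0 ≤ f i) {p : ℝ}
    (hp : 1 ≤ p) :
    ∑ i ∈ s, f i ≤ (s.card : ℝ) ^ (1 - 1 / p) * (∑ i ∈ s, f i ^ p) ^ (1 / p) := by
  have hp0 : 0 < p := by linarith
  have h := Real.rpow_sum_le_const_mul_sum_rpow s f hp
  have h1 : ∑ i ∈ s, |f i| = ∑ i ∈ s, f i := Finset.sum_congr rfl fun i hi => abs_of_nonneg (hf i hi)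
  have h2 : ∑ i ∈ s, |f i| ^ p = ∑ i ∈ s, f i ^ p :=
    Finset.sum_congr rfl fun i hi => by rw [abs_of_nonneg (hf i hi)]
  rw [h1, h2] at h
  have h3 : 0 ≤ ∑ i ∈ s, f i := Finset.sum_nonneg hf
  have h4 : 0 ≤ ∑ i ∈ s, f i ^ p := Finset.sum_nonneg fun i hi => Real.rpow_nonneg (hf i hi) _
  calc ∑ i ∈ s, f i = ((∑ i ∈ s, f i) ^ p) ^ (1 / p) := by
        rw [← Real.rpow_mul h3, mul_one_div_cancel hp0.ne', Real.rpow_one]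
    _ ≤ ((s.card : ℝ) ^ (p - 1) * ∑ i ∈ s, f i ^ p) ^ (1 / p) :=
        Real.rpow_le_rpow (by positivity) h (by positivity)
    _ = _ := by
        rw [Real.mul_rpow (by positivity) h4, ← Real.rpow_mul (by positivity)]
        congr 2
        field_simp

end Dyadic

/-! ### The dual restriction operator and its Gauss kernel. -/

section Restriction

variable {F : Type*} [Field F] [Fintype F] {n : ℕ} {χ : AddChar F ℂ}

/-- The Fourier transform of a function on `F^n × F`, restricted to the paraboloid. -/
def restrictTransform (χ : AddChar F ℂ) (g : (Fin n → F) × F → ℂ) (y : Fin n → F) : ℂ :=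
  ∑ m, χ (y ⬝ᵥ m.1 + (y ⬝ᵥ y) * m.2) * g m

theorem sum_mul_restrictTransform (h : (Fin n → F) → ℂ) (g : (Fin n → F) × F → ℂ) :
    ∑ m, liftTransform χ h m * g m = ∑ y, h y * restrictTransform χ g y := by
  simp_rw [liftTransform, restrictTransform, Finset.sum_mul, Finset.mul_sum]
  rw [Finset.sum_comm]
  exact Finset.sum_congr rfl fun y _ => Finset.sum_congr rfl fun m _ => by ring

theorem normSq_sum_eq {ι : Type*} (s : Finset ι) (φ : ι → F) (g : ι → ℂ) :
    ((‖∑ i ∈ s, χ (φ i) * g i‖ ^ 2 : ℝ) : ℂ)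
      = ∑ i ∈ s, ∑ j ∈ s, g i * (starRingEnd ℂ) (g j) * χ (φ i - φ j) := by
  rw [← Complex.normSq_eq_norm_sq, ← Complex.mul_conj, map_sum, Finset.sum_mul_sum]
  refine Finset.sum_congr rfl fun i _ => Finset.sum_congr rfl fun j _ => ?_
  rw [map_mul, ← AddChar.map_neg_eq_conj, sub_eq_add_neg, AddChar.map_add_eq_mul]
  ring

/-- The sum over the paraboloid is enlarged to all frequencies, where Plancherel is exact. -/
theorem sum_norm_restrictTransform_sq_le_plancherel (hχ : χ ≠ 1) (g : (Fin n → F) × F → ℂ) :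
    ∑ y, ‖restrictTransform χ g y‖ ^ 2
      ≤ (Fintype.card F : ℝ) ^ (n + 1) * ∑ m, ‖g m‖ ^ 2 := by
  classical
  have h1 : ∑ x : (Fin n → F) × F, ‖∑ m, χ (x.1 ⬝ᵥ m.1 + x.2 * m.2) * g m‖ ^ 2
      = (Fintype.card F : ℝ) ^ (n + 1) * ∑ m, ‖g m‖ ^ 2 := by
    have h2 : ((∑ x : (Fin n → F) × F, ‖∑ m, χ (x.1 ⬝ᵥ m.1 + x.2 * m.2) * g m‖ ^ 2 : ℝ) : ℂ)
        = (((Fintype.card F : ℝ) ^ (n + 1) * ∑ m, ‖g m‖ ^ 2 : ℝ) : ℂ) := by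
      rw [Complex.ofReal_sum]
      simp_rw [normSq_sum_eq]
      rw [Finset.sum_comm]
      push_cast
      rw [Finset.mul_sum]
      refine Finset.sum_congr rfl fun m _ => ?_
      rw [Finset.sum_comm]
      have h3 : ∀ m' : (Fin n → F) × F, ∑ x : (Fin n → F) × F, g m * (starRingEnd ℂ) (g m')
          * χ (x.1 ⬝ᵥ m.1 + x.2 * m.2 - (x.1 ⬝ᵥ m'.1 + x.2 * m'.2))
          = if m = m' then (Fintype.card F : ℂ) ^ (n + 1) * (g m * (starRingEnd ℂ) (g m'))
            else 0 := by
        intro m'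
        rw [← Finset.mul_sum]
        have h4 := sum_addChar_prod hχ (m.1 - m'.1) (m.2 - m'.2)
        have h5 : ∀ x : (Fin n → F) × F, x.1 ⬝ᵥ m.1 + x.2 * m.2 - (x.1 ⬝ᵥ m'.1 + x.2 * m'.2)
            = (m.1 - m'.1) ⬝ᵥ x.1 + (m.2 - m'.2) * x.2 := by
          intro x
          rw [sub_dotProduct, dotProduct_comm m.1, dotProduct_comm m'.1]
          ring
        simp_rw [h5, h4, sub_eq_zero, Prod.ext_iff]
        split_ifs <;> ring
      simp_rw [h3]
      rw [Finset.sum_ite_eq, if_pos (Finset.mem_univ _), Complex.mul_conj,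
        Complex.normSq_eq_norm_sq]
      push_cast
      ring
    exact_mod_cast h2
  rw [← h1]
  have h2 := Finset.sum_le_sum_of_subset_of_nonneg
    (f := fun x : (Fin n → F) × F => ‖∑ m, χ (x.1 ⬝ᵥ m.1 + x.2 * m.2) * g m‖ ^ 2)
    (Finset.subset_univ (Finset.univ.map ⟨fun y : Fin n → F => (y, y ⬝ᵥ y),
      fun a b hab => (Prod.ext_iff.mp hab).1⟩)) (fun _ _ _ => sq_nonneg _)
  rw [Finset.sum_map] at h2
  exact h2

open Classical in
theorem sum_addChar_lift_sub {k : ℕ} (hk : Odd k) (hn : n = 2 * k) (hχ : χ ≠ 1)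
    (hs : ¬ IsSquare (-1 : F)) (m m' : (Fin n → F) × F) :
    ∑ y : Fin n → F, χ (y ⬝ᵥ m.1 + (y ⬝ᵥ y) * m.2 - (y ⬝ᵥ m'.1 + (y ⬝ᵥ y) * m'.2))
      = (if m = m' then (Fintype.card F : ℂ) ^ n else 0)
        + if m.2 = m'.2 then 0 else -(Fintype.card F : ℂ) ^ k
          * χ (-(((m.1 - m'.1) ⬝ᵥ (m.1 - m'.1)) / (4 * (m.2 - m'.2)))) := by
  by_cases h : m.2 = m'.2
  · rw [if_pos h, add_zero]
    have h1 := sum_addChar_dotProduct hχ (m.1 - m'.1)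
    simp only [sub_eq_zero] at h1
    simp only [Prod.ext_iff, h, and_true]
    rw [← h1]
    refine Finset.sum_congr rfl fun y _ => ?_
    rw [dotProduct_sub]
    congr 1
    ring
  · rw [if_neg h, if_neg (fun e => h (congrArg Prod.snd e)), zero_add,
      ← sum_addChar_quadratic_dotProduct hk hn hχ hs (sub_ne_zero.mpr h)]
    refine Finset.sum_congr rfl fun y _ => ?_
    rw [dotProduct_sub]
    congr 1
    ring

/-- Expanding (x - y)·(x - y), the term in x·x factors out with modulus 1, and the rest is a linear
plus a quadratic phase in y. -/
theorem norm_sum_addChar_eq_liftTransform (hs : ¬ IsSquare (-1 : F)) (h : (Fin n → F) → ℂ)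
    (x : Fin n → F) {u : F} (hu : u ≠ 0) :
    ‖∑ y, h y * χ (-(((x - y) ⬝ᵥ (x - y)) / (4 * u)))‖
      = ‖liftTransform χ h ((2 * u)⁻¹ • x, -(4 * u)⁻¹)‖ := by
  have h2 := two_ne_zero_of_not_isSquare hs
  have h4 : (4 : F) ≠ 0 := by
    rw [show (4 : F) = 2 * 2 by norm_num]
    exact mul_ne_zero h2 h2
  have h1 : ∑ y, h y * χ (-(((x - y) ⬝ᵥ (x - y)) / (4 * u)))
      = χ (-((x ⬝ᵥ x) / (4 * u))) * liftTransform χ h ((2 * u)⁻¹ • x, -(4 * u)⁻¹) := by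
    rw [liftTransform, Finset.mul_sum]
    refine Finset.sum_congr rfl fun y _ => ?_
    rw [← mul_assoc, ← AddChar.map_add_eq_mul, mul_comm]
    congr 2
    simp only [sub_dotProduct, dotProduct_sub, dotProduct_smul, smul_eq_mul]
    rw [dotProduct_comm y x]
    have : (2 * u)⁻¹ = 2 * (4 * u)⁻¹ := by field_simp; norm_num
    rw [this]
    field_simp
    ring
  rw [h1, norm_mul, AddChar.norm_apply, one_mul]

end Restriction

/-! ### L^2 restriction estimates for functions bounded by the indicator of a set. -/

section RestrictionBound

variable {F : Type*} [Field F] [Fintype F] {n : ℕ} {χ : AddChar F ℂ}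

/-- The contribution to the restriction estimate of the points of `G` off the hyperplane
`{m | m.2 = z}` against a function supported on that hyperplane. -/
theorem sum_norm_liftTransform_shear_le (hs : ¬ IsSquare (-1 : F)) (h : (Fin n → F) → ℂ) (z : F)
    (G : Finset ((Fin n → F) × F)) (hG : ∀ m ∈ G, m.2 ≠ z) :
    ∑ m ∈ G, ‖∑ y, h y * χ (-(((m.1 - y) ⬝ᵥ (m.1 - y)) / (4 * (m.2 - z))))‖
      ≤ (G.card : ℝ) ^ (3 / 4 : ℝ) * (∑ m, ‖liftTransform χ h m‖ ^ (4 : ℝ)) ^ (1 / 4 : ℝ) := by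
  classical
  have h2 := two_ne_zero_of_not_isSquare hs
  have h4 : (4 : F) ≠ 0 := by
    rw [show (4 : F) = 2 * 2 by norm_num]
    exact mul_ne_zero h2 h2
  have h1 := sum_le_card_rpow_mul G
    (fun m => ‖∑ y, h y * χ (-(((m.1 - y) ⬝ᵥ (m.1 - y)) / (4 * (m.2 - z))))‖)
    (fun _ _ => norm_nonneg _) (p := 4) (by norm_num)
  refine h1.trans ?_
  rw [show (1 - 1 / 4 : ℝ) = 3 / 4 by norm_num]
  refine mul_le_mul_of_nonneg_left (Real.rpow_le_rpow (by positivity) ?_ (by norm_num))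
    (by positivity)
  -- The change of variables (x, u) ↦ (x/(2u), -1/(4u)) with u = m.2 - z. It is injective off u = 0,
  -- so the fourth moment over G is at most the full one.
  set φ : (Fin n → F) × F → (Fin n → F) × F := fun m =>
    ((2 * (m.2 - z))⁻¹ • m.1, -(4 * (m.2 - z))⁻¹) with hφ
  have h3 : ∑ m ∈ G, ‖∑ y, h y * χ (-(((m.1 - y) ⬝ᵥ (m.1 - y)) / (4 * (m.2 - z))))‖ ^ (4 : ℝ)
      = ∑ m ∈ G, ‖liftTransform χ h (φ m)‖ ^ (4 : ℝ) := by
    refine Finset.sum_congr rfl fun m hm => ?_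
    rw [norm_sum_addChar_eq_liftTransform hs h m.1 (sub_ne_zero.mpr (hG m hm))]
  have hinj : Set.InjOn φ G := by
    intro a ha b hb hab
    have ha' := sub_ne_zero.mpr (hG a ha)
    have hb' := sub_ne_zero.mpr (hG b hb)
    simp only [hφ, Prod.mk.injEq, neg_inj, inv_inj] at hab
    have h5 : a.2 - z = b.2 - z := mul_left_cancel₀ h4 hab.2
    have h6 := hab.1
    rw [h5] at h6
    have h7 := smul_right_injective (Fin n → F) (inv_ne_zero (mul_ne_zero h2 hb')) h6
    exact Prod.ext h7 (sub_left_injective h5)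
  rw [h3, ← Finset.sum_image (f := fun m => ‖liftTransform χ h m‖ ^ (4 : ℝ)) hinj]
  exact Finset.sum_le_sum_of_subset_of_nonneg (Finset.subset_univ _) fun _ _ _ => by positivity

open Classical in
-- The diagonal of the kernel gives q^n |G|. Points at equal height but distinct do not interact, so
-- the remainder pairs G with each slice only from off that slice.
theorem sum_norm_restrictTransform_sq_le_slices {k : ℕ} (hk : Odd k) (hn : n = 2 * k)
    (hχ : χ ≠ 1) (hs : ¬ IsSquare (-1 : F)) (G : Finset ((Fin n → F) × F))
    (g : (Fin n → F) × F → ℂ) (h1 : ∀ m ∈ G, ‖g m‖ ≤ 1) (h0 : ∀ m ∉ G, g m = 0) :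
    ∑ y, ‖restrictTransform χ g y‖ ^ 2 ≤ (Fintype.card F : ℝ) ^ n * G.card
      + (Fintype.card F : ℝ) ^ k * (G.card : ℝ) ^ (3 / 4 : ℝ) * ∑ z,
        (∑ m, ‖liftTransform χ (fun y => (starRingEnd ℂ) (g (y, z))) m‖ ^ (4 : ℝ)) ^ (1 / 4 : ℝ) := by
  set q := Fintype.card F
  have hg1 : ∀ m, ‖g m‖ ≤ 1 := fun m => by
    by_cases hm : m ∈ G
    · exact h1 m hm
    · rw [h0 m hm, norm_zero]; exact zero_le_one
  set J : (Fin n → F) × F → (Fin n → F) × F → ℂ := fun m m' =>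
    if m.2 = m'.2 then 0 else
      χ (-(((m.1 - m'.1) ⬝ᵥ (m.1 - m'.1)) / (4 * (m.2 - m'.2)))) with hJ
  have hexp : ((∑ y, ‖restrictTransform χ g y‖ ^ 2 : ℝ) : ℂ)
      = (q : ℂ) ^ n * ∑ m ∈ G, g m * (starRingEnd ℂ) (g m)
        - (q : ℂ) ^ k * ∑ z, ∑ m ∈ G, g m * ∑ y, (starRingEnd ℂ) (g (y, z)) * J m (y, z) := by
    rw [Complex.ofReal_sum]
    simp_rw [restrictTransform, normSq_sum_eq]
    rw [Finset.sum_comm]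
    have h2 : ∀ m : (Fin n → F) × F, ∑ y : Fin n → F, ∑ m', g m * (starRingEnd ℂ) (g m') *
        χ (y ⬝ᵥ m.1 + (y ⬝ᵥ y) * m.2 - (y ⬝ᵥ m'.1 + (y ⬝ᵥ y) * m'.2))
        = (q : ℂ) ^ n * (g m * (starRingEnd ℂ) (g m))
          - (q : ℂ) ^ k * (g m * ∑ m', (starRingEnd ℂ) (g m') * J m m') := by
      intro m
      rw [Finset.sum_comm]
      simp_rw [← Finset.mul_sum, sum_addChar_lift_sub hk hn hχ hs, mul_add]
      rw [Finset.sum_add_distrib, sub_eq_add_neg]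
      congr 1
      · simp only [mul_ite, mul_zero]
        rw [Finset.sum_ite_eq, if_pos (Finset.mem_univ _)]
        ring
      · rw [Finset.mul_sum, Finset.mul_sum, ← Finset.sum_neg_distrib]
        refine Finset.sum_congr rfl fun m' _ => ?_
        simp only [hJ]
        split_ifs <;> ring
    simp_rw [h2]
    rw [← Finset.sum_subset (Finset.subset_univ G) (fun m _ hm => by simp [h0 m hm]),
      Finset.sum_sub_distrib, ← Finset.mul_sum, ← Finset.mul_sum]
    congr 2
    rw [Finset.sum_comm]
    refine Finset.sum_congr rfl fun m _ => ?_
    rw [← Finset.mul_sum, Fintype.sum_prod_type_right]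
  have hre := congrArg norm hexp
  rw [Complex.norm_real, Real.norm_of_nonneg (by positivity)] at hre
  rw [hre]
  refine (norm_sub_le _ _).trans (add_le_add ?_ ?_)
  · rw [norm_mul, norm_pow, Complex.norm_natCast]
    gcongr
    refine (norm_sum_le _ _).trans ?_
    calc _ ≤ ∑ m ∈ G, (1 : ℝ) := by
          refine Finset.sum_le_sum fun m _ => ?_
          rw [norm_mul, RCLike.norm_conj]
          exact mul_le_one₀ (hg1 m) (norm_nonneg _) (hg1 m)
      _ = _ := by simp
  · rw [norm_mul, norm_pow, Complex.norm_natCast, mul_assoc, Finset.mul_sum]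
    gcongr
    refine (norm_sum_le _ _).trans (Finset.sum_le_sum fun z _ => ?_)
    set h : (Fin n → F) → ℂ := fun y => (starRingEnd ℂ) (g (y, z)) with hh
    calc _ ≤ ∑ m ∈ G, ‖∑ y, h y * J m (y, z)‖ := by
          refine (norm_sum_le _ _).trans (Finset.sum_le_sum fun m _ => ?_)
          rw [norm_mul]
          exact mul_le_of_le_one_left (norm_nonneg _) (hg1 m)
      _ = ∑ m ∈ G.filter (fun m => m.2 ≠ z),
          ‖∑ y, h y * χ (-(((m.1 - y) ⬝ᵥ (m.1 - y)) / (4 * (m.2 - z))))‖ := by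
          rw [Finset.sum_filter]
          refine Finset.sum_congr rfl fun m _ => ?_
          by_cases hm : m.2 = z <;> simp [hJ, hm]
      _ ≤ _ := sum_norm_liftTransform_shear_le hs h z _ fun m hm => (Finset.mem_filter.mp hm).2
      _ ≤ _ := by
          gcongr
          exact Finset.filter_subset _ _

theorem sum_norm_restrictTransform_sq_le_card {k : ℕ} (hk : Odd k) (hk3 : 3 ≤ k) (hn : n = 2 * k)
    (hχ : χ ≠ 1) (hs : ¬ IsSquare (-1 : F)) {d : ℝ} (hd : d = n + 1)
    (G : Finset ((Fin n → F) × F)) (g : (Fin n → F) × F → ℂ) (h1 : ∀ m ∈ G, ‖g m‖ ≤ 1)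
    (h0 : ∀ m ∉ G, g m = 0) :
    ∑ y, ‖restrictTransform χ g y‖ ^ 2 ≤ (Fintype.card F : ℝ) ^ n * G.card
      + 2 * (Fintype.card F : ℝ) ^ (3 / 4 * d) * (G.card : ℝ) ^ (3 / 2 - 1 / (2 * d)) := by
  classical
  rcases G.eq_empty_or_nonempty with rfl | hG
  · have : g = 0 := by
      ext m
      exact h0 m (Finset.notMem_empty m)
    subst this
    have h2 : ∑ y, ‖restrictTransform χ (0 : (Fin n → F) × F → ℂ) y‖ ^ 2 = 0 := by
      simp [restrictTransform]
    rw [h2]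
    positivity
  have hN0 : (0 : ℝ) < G.card := by exact_mod_cast hG.card_pos
  have hq0 : (0 : ℝ) < Fintype.card F := by exact_mod_cast Fintype.card_pos
  have hd7 : 7 ≤ d := by
    have : (3 : ℝ) ≤ k := by exact_mod_cast hk3
    rw [hd, hn]; push_cast; linarith
  have hk' : (k : ℝ) = (d - 1) / 2 := by
    rw [hd, hn]; push_cast; ring
  have hslices := sum_norm_restrictTransform_sq_le_slices hk hn hχ hs G g h1 h0
  set α : ℝ := 3 / 4 - 1 / (2 * d) with hα
  have hi : 1 / (2 * d) ≤ 1 / 14 := by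
    apply one_div_le_one_div_of_le <;> linarith
  have hi0 : 0 < 1 / (2 * d) := by positivity
  have hα0 : 0 < α := by linarith
  have hα1 : α ≤ 1 := by linarith
  set Gz : F → Finset (Fin n → F) := fun z => Finset.univ.filter fun y => (y, z) ∈ G with hGz
  have hcard : ∑ z, ((Gz z).card : ℝ) = G.card := by
    have h2 : ∀ z, (Gz z).card = (G.filter fun m => m.2 = z).card := by
      intro z
      refine Finset.card_bij (fun y _ => (y, z)) ?_ ?_ ?_
      · intro y hy
        simpa [hGz] using hy
      · intro a _ b _ hab
        exact (Prod.ext_iff.mp hab).1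
      · rintro ⟨y, t⟩ hm
        simp only [Finset.mem_filter] at hm
        obtain ⟨hm, rfl⟩ := hm
        exact ⟨y, by simpa [hGz] using hm, rfl⟩
    simp_rw [h2]
    exact_mod_cast (Finset.card_eq_sum_card_fiberwise (f := fun m : (Fin n → F) × F => m.2)
      (t := Finset.univ) (s := G) fun _ _ => by simp).symm
  set q : ℝ := (Fintype.card F : ℝ) with hq
  set c := 2 * q ^ (d / 4 + 1 / 4 - 1 / (2 * d)) with hc
  have hc0 : 0 < c := by positivity
  have hsum : ∑ z, (∑ m, ‖liftTransform χ (fun y => (starRingEnd ℂ) (g (y, z))) m‖ ^ (4 : ℝ))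
      ^ (1 / 4 : ℝ) ≤ c * (q ^ (1 - α) * (G.card : ℝ) ^ α) := by
    calc _ ≤ ∑ z, c * ((Gz z).card : ℝ) ^ α := by
          refine Finset.sum_le_sum fun z _ => ?_
          refine sum_norm_liftTransform_rpow_le hk hk3 hn hχ hs hd (Gz z) _ ?_ ?_
          · intro y hy
            rw [RCLike.norm_conj]
            exact h1 _ (Finset.mem_filter.mp hy).2
          · intro y hy
            have : (y, z) ∉ G := by simpa [hGz] using hy
            rw [h0 _ this, map_zero]
      _ = c * ∑ z, ((Gz z).card : ℝ) ^ α := by rw [Finset.mul_sum]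
      _ ≤ _ := by
          gcongr
          -- Hölder over the q slices, whose sizes add up to |G|.
          have h2 := sum_le_card_rpow_mul Finset.univ (fun z => ((Gz z).card : ℝ) ^ α)
            (fun _ _ => by positivity) (p := 1 / α) ((one_le_div hα0).mpr hα1)
          have h3 : ∀ z, (((Gz z).card : ℝ) ^ α) ^ (1 / α) = (Gz z).card := by
            intro z
            rw [← Real.rpow_mul (by positivity), mul_one_div_cancel hα0.ne', Real.rpow_one]
          simp_rw [h3, hcard, one_div_one_div, Finset.card_univ] at h2
          exact h2
  refine hslices.trans (add_le_add le_rfl ?_)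
  calc _ ≤ q ^ k * (G.card : ℝ) ^ (3 / 4 : ℝ) * (c * (q ^ (1 - α) * (G.card : ℝ) ^ α)) := by
        gcongr
    _ = 2 * (q ^ (k : ℝ) * q ^ (d / 4 + 1 / 4 - 1 / (2 * d)) * q ^ (1 - α))
        * ((G.card : ℝ) ^ (3 / 4 : ℝ) * (G.card : ℝ) ^ α) := by
        rw [hc, Real.rpow_natCast]
        ring
    _ = _ := by
        rw [← Real.rpow_add hq0, ← Real.rpow_add hq0, ← Real.rpow_add hN0, hk', hα]
        congr 2
        · congr 1
          ring
        · ring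

/-- At |G| = q^(d²/(2(d-1))) the Plancherel bound, the slice term q^(3d/4) |G|^(3/2-1/(2d)) and the
target all agree up to constants. Below this size the slice bound is used, above it Plancherel. -/
theorem sum_norm_restrictTransform_sq_le {k : ℕ} (hk : Odd k) (hk3 : 3 ≤ k) (hn : n = 2 * k)
    (hχ : χ ≠ 1) (hs : ¬ IsSquare (-1 : F)) {d : ℝ} (hd : d = n + 1)
    (G : Finset ((Fin n → F) × F)) (g : (Fin n → F) × F → ℂ) (h1 : ∀ m ∈ G, ‖g m‖ ≤ 1)
    (h0 : ∀ m ∉ G, g m = 0) :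
    ∑ y, ‖restrictTransform χ g y‖ ^ 2
      ≤ 3 * ((Fintype.card F : ℝ) ^ n * (G.card : ℝ) ^ (1 + 2 / d - 2 / d ^ 2)) := by
  have hA := sum_norm_restrictTransform_sq_le_card hk hk3 hn hχ hs hd G g h1 h0
  have hB : ∑ y, ‖restrictTransform χ g y‖ ^ 2 ≤ (Fintype.card F : ℝ) ^ (n + 1) * G.card := by
    refine (sum_norm_restrictTransform_sq_le_plancherel hχ g).trans ?_
    gcongr
    rw [← Finset.sum_subset (Finset.subset_univ G) (fun m _ hm => by simp [h0 m hm])]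
    calc _ ≤ ∑ m ∈ G, (1 : ℝ) := Finset.sum_le_sum fun m hm => pow_le_one₀ (norm_nonneg _) (h1 m hm)
      _ = _ := by simp
  rcases G.eq_empty_or_nonempty with rfl | hG
  · refine hB.trans ?_
    simp only [Finset.card_empty, Nat.cast_zero, mul_zero]
    positivity
  have hN1 : (1 : ℝ) ≤ G.card := by exact_mod_cast hG.card_pos
  have hq1 : (1 : ℝ) < Fintype.card F := by exact_mod_cast Fintype.one_lt_card
  set q : ℝ := (Fintype.card F : ℝ)
  set N : ℝ := (G.card : ℝ)
  have hq0 : 0 < q := by linarith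
  have hd7 : 7 ≤ d := by
    have : (3 : ℝ) ≤ k := by exact_mod_cast hk3
    rw [hd, hn]; push_cast; linarith
  obtain ⟨x, hx⟩ : ∃ x : ℝ, N = q ^ x :=
    ⟨Real.logb q N, (Real.rpow_logb hq0 hq1.ne' (by linarith)).symm⟩
  have hx0 : 0 ≤ x := by
    rw [hx, ← Real.rpow_zero q, Real.rpow_le_rpow_left_iff hq1] at hN1
    exact hN1
  have hqn : q ^ n = q ^ (d - 1) := by
    rw [← Real.rpow_natCast q n]
    congr 1
    linarith
  have hT : q ^ n * N ^ (1 + 2 / d - 2 / d ^ 2) = q ^ (d - 1 + x * (1 + 2 / d - 2 / d ^ 2)) := by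
    rw [hx, hqn, ← Real.rpow_mul hq0.le, ← Real.rpow_add hq0]
  rw [hT]
  have hgain : 0 ≤ 2 / d - 2 / d ^ 2 := by
    rw [sub_nonneg]
    gcongr
    nlinarith
  rcases le_total x (d ^ 2 / (2 * (d - 1))) with hc | hc
  · have h2 : q ^ n * N ≤ q ^ (d - 1 + x * (1 + 2 / d - 2 / d ^ 2)) := by
      rw [hqn, hx, ← Real.rpow_add hq0, Real.rpow_le_rpow_left_iff hq1]
      nlinarith
    have h3 : q ^ (3 / 4 * d) * N ^ (3 / 2 - 1 / (2 * d))
        ≤ q ^ (d - 1 + x * (1 + 2 / d - 2 / d ^ 2)) := by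
      rw [hx, ← Real.rpow_mul hq0.le, ← Real.rpow_add hq0, Real.rpow_le_rpow_left_iff hq1]
      have h4 : 0 ≤ (d - 1) * (d - 4) / (2 * d ^ 2) := by
        apply div_nonneg (mul_nonneg (by linarith) (by linarith)) (by positivity)
      have h5 : x * ((d - 1) * (d - 4) / (2 * d ^ 2))
          ≤ d ^ 2 / (2 * (d - 1)) * ((d - 1) * (d - 4) / (2 * d ^ 2)) := by gcongr
      have h6 : d ^ 2 / (2 * (d - 1)) * ((d - 1) * (d - 4) / (2 * d ^ 2)) = (d - 4) / 4 := by
        have : d - 1 ≠ 0 := by linarith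
        field_simp
        norm_num
      have h7 : x * ((d - 1) * (d - 4) / (2 * d ^ 2))
          = x * (3 / 2 - 1 / (2 * d)) - x * (1 + 2 / d - 2 / d ^ 2) := by
        field_simp
        ring
      linarith
    linarith
  · have h2 : q ^ (n + 1) * N ≤ q ^ (d - 1 + x * (1 + 2 / d - 2 / d ^ 2)) := by
      rw [pow_succ, hqn, hx, ← Real.rpow_add_one hq0.ne', ← Real.rpow_add hq0,
        Real.rpow_le_rpow_left_iff hq1]
      have h5 : d ^ 2 / (2 * (d - 1)) * (2 / d - 2 / d ^ 2) ≤ x * (2 / d - 2 / d ^ 2) := by gcongr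
      have h6 : d ^ 2 / (2 * (d - 1)) * (2 / d - 2 / d ^ 2) = 1 := by
        have : d - 1 ≠ 0 := by linarith
        field_simp
      linarith
    have : 0 < q ^ (d - 1 + x * (1 + 2 / d - 2 / d ^ 2)) := Real.rpow_pos_of_pos hq0 _
    linarith

end RestrictionBound

/-! ### Strong type estimates and duality. -/

section StrongType

variable {F : Type*} [Field F] [Fintype F] {n : ℕ} {χ : AddChar F ℂ}

/-- `liftTransform` as a linear map into `ℓ^4`. -/
def liftTransformLp (χ : AddChar F ℂ) (n : ℕ) :
    ((Fin n → F) → ℂ) →ₗ[ℂ] PiLp 4 (fun _ : (Fin n → F) × F => ℂ) where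
  toFun h := WithLp.toLp 4 (liftTransform χ h)
  map_add' h g := by
    ext m
    simp [liftTransform, mul_add, Finset.sum_add_distrib]
  map_smul' c h := by
    ext m
    simp [liftTransform, Finset.mul_sum, mul_left_comm]

/-- `restrictTransform` as a linear map into `ℓ^2`. -/
def restrictTransformLp (χ : AddChar F ℂ) (n : ℕ) :
    ((Fin n → F) × F → ℂ) →ₗ[ℂ] PiLp 2 (fun _ : Fin n → F => ℂ) where
  toFun g := WithLp.toLp 2 (restrictTransform χ g)
  map_add' h g := by
    ext m
    simp [restrictTransform, mul_add, Finset.sum_add_distrib]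
  map_smul' c h := by
    ext m
    simp [restrictTransform, Finset.mul_sum, mul_left_comm]

theorem norm_toLp_four {ι : Type*} [Fintype ι] (f : ι → ℂ) :
    ‖(WithLp.toLp 4 f : PiLp 4 (fun _ : ι => ℂ))‖ = (∑ i, ‖f i‖ ^ (4 : ℝ)) ^ (1 / 4 : ℝ) := by
  have := PiLp.norm_eq_sum (p := 4) (β := fun _ : ι => ℂ) (by norm_num) (WithLp.toLp 4 f)
  simpa using this

theorem liftTransform_strong_type {k : ℕ} (hk : Odd k) (hk3 : 3 ≤ k) (hn : n = 2 * k)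
    (hχ : χ ≠ 1) (hs : ¬ IsSquare (-1 : F)) {d : ℝ} (hd : d = n + 1) {K : ℕ}
    (hK : Fintype.card F ^ (n + 1) ≤ 2 ^ K) (h : (Fin n → F) → ℂ) :
    (∑ m, ‖liftTransform χ h m‖ ^ (4 : ℝ)) ^ (1 / 4 : ℝ)
      ≤ 2 * (Fintype.card F : ℝ) ^ (d / 4 + 1 / 4 - 1 / (2 * d)) * (2 * K + 1)
        * (∑ y, ‖h y‖ ^ (1 / (3 / 4 - 1 / (2 * d)))) ^ (3 / 4 - 1 / (2 * d)) := by
  have : Fact ((1 : ℝ≥0∞) ≤ 4) := ⟨by norm_num⟩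
  have hd1 : 1 ≤ d := by rw [hd]; linarith [(Nat.cast_nonneg n : (0 : ℝ) ≤ n)]
  have hi : 1 / (2 * d) ≤ 1 / 2 := by
    apply one_div_le_one_div_of_le <;> linarith
  have hi0 : 0 < 1 / (2 * d) := by positivity
  have := norm_le_of_restricted (liftTransformLp χ n) (s := 3 / 4 - 1 / (2 * d))
    (B := 2 * (Fintype.card F : ℝ) ^ (d / 4 + 1 / 4 - 1 / (2 * d))) (by linarith) (by linarith)
    (by positivity)
    (fun E h h1 h0 => by
      rw [liftTransformLp, LinearMap.coe_mk, AddHom.coe_mk, norm_toLp_four]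
      exact sum_norm_liftTransform_rpow_le hk hk3 hn hχ hs hd E h h1 h0)
    (K := K)
    (by
      refine le_trans ?_ hK
      simp only [Fintype.card_fun, Fintype.card_fin]
      exact Nat.pow_le_pow_right Fintype.card_pos (Nat.le_succ n)) h
  rw [liftTransformLp, LinearMap.coe_mk, AddHom.coe_mk, norm_toLp_four] at this
  exact this

theorem restrictTransform_strong_type {k : ℕ} (hk : Odd k) (hk3 : 3 ≤ k) (hn : n = 2 * k)
    (hχ : χ ≠ 1) (hs : ¬ IsSquare (-1 : F)) {d : ℝ} (hd : d = n + 1) {K : ℕ}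
    (hK : Fintype.card F ^ (n + 1) ≤ 2 ^ K) {s : ℝ} (hsd : s = 1 / 2 + 1 / d - 1 / d ^ 2)
    (hs0 : 0 < s) (hs1 : s ≤ 1) (g : (Fin n → F) × F → ℂ) :
    √(∑ y, ‖restrictTransform χ g y‖ ^ 2)
      ≤ 2 * √((Fintype.card F : ℝ) ^ n) * (2 * K + 1) * (∑ m, ‖g m‖ ^ (1 / s)) ^ s := by
  have hnorm : ∀ g, ‖restrictTransformLp χ n g‖ = √(∑ y, ‖restrictTransform χ g y‖ ^ 2) :=
    fun g => EuclideanSpace.norm_eq _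
  rw [← hnorm]
  refine norm_le_of_restricted (restrictTransformLp χ n) hs0 hs1 (by positivity)
    (fun E h h1 h0 => ?_) ?_ g
  · rw [hnorm]
    apply Real.sqrt_le_iff.mpr
    refine ⟨by positivity, (sum_norm_restrictTransform_sq_le hk hk3 hn hχ hs hd E h h1 h0).trans ?_⟩
    rw [mul_pow, mul_pow, Real.sq_sqrt (by positivity), ← Real.rpow_natCast (_ ^ s) 2,
      ← Real.rpow_mul (by positivity)]
    have : s * ((2 : ℕ) : ℝ) = 1 + 2 / d - 2 / d ^ 2 := by
      rw [hsd]; push_cast; ring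
    rw [this]
    have : 0 ≤ (Fintype.card F : ℝ) ^ n * (E.card : ℝ) ^ (1 + 2 / d - 2 / d ^ 2) := by positivity
    linarith
  · simpa [pow_succ] using hK

/-- Duality between the restriction and the extension operator. -/
theorem liftTransform_le_of_restrictTransform_le {r D : ℝ} (hr : 2 < r)
    (hD : ∀ g : (Fin n → F) × F → ℂ, √(∑ y, ‖restrictTransform χ g y‖ ^ 2)
      ≤ D * (∑ m, ‖g m‖ ^ (1 / (1 - 1 / r))) ^ (1 - 1 / r)) (h : (Fin n → F) → ℂ) :
    (∑ m, ‖liftTransform χ h m‖ ^ r) ^ (1 / r) ≤ D * √(∑ y, ‖h y‖ ^ 2) := by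
  have hr0 : 0 < r := by linarith
  set u := liftTransform χ h with hu
  set A := ∑ m, ‖u m‖ ^ r with hA
  have hA0 : 0 ≤ A := by positivity
  -- The extremal function in the duality of ℓ^r with its conjugate exponent: pairing it with u
  -- gives the r-th power sum A.
  set g : (Fin n → F) × F → ℂ := fun m => (starRingEnd ℂ) (u m) * ((‖u m‖ ^ (r - 2) : ℝ) : ℂ) with hg
  have hgn : ∀ m, ‖g m‖ = ‖u m‖ ^ (r - 1) := by
    intro m
    simp only [hg]
    rw [norm_mul, RCLike.norm_conj, Complex.norm_real, Real.norm_of_nonneg (by positivity)]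
    rcases eq_or_ne ‖u m‖ 0 with h0 | h0
    · rw [h0, zero_mul, Real.zero_rpow (by linarith)]
    · rw [show r - 1 = (r - 2) + 1 by ring, Real.rpow_add_one h0, mul_comm]
  have hgA : ∑ m, ‖g m‖ ^ (1 / (1 - 1 / r)) = A := by
    refine Finset.sum_congr rfl fun m _ => ?_
    rw [hgn, ← Real.rpow_mul (norm_nonneg _)]
    congr 1
    have : r - 1 ≠ 0 := by linarith
    field_simp
  have hug : ∑ m, u m * g m = (A : ℂ) := by
    rw [hA, Complex.ofReal_sum]
    refine Finset.sum_congr rfl fun m _ => ?_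
    simp only [hg]
    rw [← mul_assoc, Complex.mul_conj, Complex.normSq_eq_norm_sq, ← Complex.ofReal_mul]
    congr 1
    rcases eq_or_ne ‖u m‖ 0 with h0 | h0
    · rw [h0]; simp [Real.zero_rpow hr0.ne']
    · have := Real.rpow_add (lt_of_le_of_ne (norm_nonneg (u m)) h0.symm) 2 (r - 2)
      rw [show 2 + (r - 2) = r by ring] at this
      rw [this]
      norm_num
  have hle : A ≤ √(∑ y, ‖h y‖ ^ 2) * (D * A ^ (1 - 1 / r)) := by
    have h1 : A = ‖∑ m, u m * g m‖ := by
      rw [hug, Complex.norm_real, Real.norm_of_nonneg hA0]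
    calc A = ‖∑ y, h y * restrictTransform χ g y‖ := by rw [h1, hu, sum_mul_restrictTransform]
      _ ≤ ∑ y, ‖h y‖ * ‖restrictTransform χ g y‖ :=
          (norm_sum_le _ _).trans (le_of_eq (Finset.sum_congr rfl fun y _ => norm_mul _ _))
      _ ≤ √(∑ y, ‖h y‖ ^ 2) * √(∑ y, ‖restrictTransform χ g y‖ ^ 2) :=
          Real.sum_mul_le_sqrt_mul_sqrt _ _ _
      _ ≤ _ := by
          gcongr
          have := hD g
          rwa [hgA] at this
  rcases hA0.eq_or_lt with h0 | h0
  · rw [← h0, Real.zero_rpow (by positivity)]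
    -- When A = 0 the claim still needs D ≥ 0, which testing the hypothesis on the constant function
    -- 1 supplies.
    have h2 := (Real.sqrt_nonneg _).trans (hD fun _ => 1)
    have h3 : 0 < ∑ m : (Fin n → F) × F, ‖(1 : ℂ)‖ ^ (1 / (1 - 1 / r)) := by
      rw [norm_one, Real.one_rpow]
      simp [Fintype.card_pos]
    have : 0 ≤ D := nonneg_of_mul_nonneg_left h2 (Real.rpow_pos_of_pos h3 _)
    positivity
  · have h1 : A = A ^ (1 / r) * A ^ (1 - 1 / r) := by
      rw [← Real.rpow_add h0]; simp
    have h2 : 0 < A ^ (1 - 1 / r) := Real.rpow_pos_of_pos h0 _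
    refine le_of_mul_le_mul_right ?_ h2
    rw [← h1]
    linarith

end StrongType

/-! ### Monotonicity of the norms in the exponent, reducing each range to its endpoint. -/

section Norms

variable {α : Type*} [Fintype α]

theorem countNorm_nonneg (r : ℝ≥0∞) (g : α → ℂ) : 0 ≤ countNorm r g := by
  unfold countNorm
  split_ifs
  · exact Real.iSup_nonneg fun _ => norm_nonneg _
  · positivity

theorem countNorm_ofReal {r : ℝ} (hr : 0 ≤ r) (g : α → ℂ) :
    countNorm (ENNReal.ofReal r) g = (∑ m, ‖g m‖ ^ r) ^ (1 / r) := by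
  rw [countNorm, if_neg ENNReal.ofReal_ne_top, ENNReal.toReal_ofReal hr]

theorem avgNorm_ofReal {r : ℝ} (hr : 0 ≤ r) (g : α → ℂ) :
    avgNorm (ENNReal.ofReal r) g = ((Fintype.card α : ℝ)⁻¹ * ∑ m, ‖g m‖ ^ r) ^ (1 / r) := by
  rw [avgNorm, if_neg ENNReal.ofReal_ne_top, ENNReal.toReal_ofReal hr]

theorem countNorm_antitone [Nonempty α] {r₀ : ℝ} (hr₀ : 0 < r₀) {r : ℝ≥0∞}
    (hr : ENNReal.ofReal r₀ ≤ r) (g : α → ℂ) :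
    countNorm r g ≤ countNorm (ENNReal.ofReal r₀) g := by
  have hpt : ∀ m, ‖g m‖ ≤ countNorm (ENNReal.ofReal r₀) g := by
    intro m
    rw [countNorm_ofReal hr₀.le]
    calc ‖g m‖ = (‖g m‖ ^ r₀) ^ (1 / r₀) := by
          rw [← Real.rpow_mul (norm_nonneg _), mul_one_div_cancel hr₀.ne', Real.rpow_one]
      _ ≤ _ := Real.rpow_le_rpow (by positivity)
          (Finset.single_le_sum (f := fun m => ‖g m‖ ^ r₀) (fun _ _ => by positivity)
            (Finset.mem_univ m)) (by positivity)
  have hN0 := countNorm_nonneg (ENNReal.ofReal r₀) g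
  rw [countNorm]
  split_ifs with h
  · exact ciSup_le hpt
  · have hr1 : r₀ ≤ r.toReal := (ENNReal.ofReal_le_iff_le_toReal h).mp hr
    have hrpos : 0 < r.toReal := by linarith
    set N := countNorm (ENNReal.ofReal r₀) g with hN
    have hNr : N ^ r₀ = ∑ m, ‖g m‖ ^ r₀ := by
      rw [hN, countNorm_ofReal hr₀.le, ← Real.rpow_mul (by positivity),
        one_div_mul_cancel hr₀.ne', Real.rpow_one]
    have h1 : ∑ m, ‖g m‖ ^ r.toReal ≤ N ^ r.toReal := by
      calc ∑ m, ‖g m‖ ^ r.toReal = ∑ m, ‖g m‖ ^ r₀ * ‖g m‖ ^ (r.toReal - r₀) := by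
            refine Finset.sum_congr rfl fun m _ => ?_
            rw [← Real.rpow_add_of_nonneg (norm_nonneg _) hr₀.le (by linarith)]
            congr 1
            ring
        _ ≤ ∑ m, ‖g m‖ ^ r₀ * N ^ (r.toReal - r₀) := by
            gcongr with m _
            exact hpt m
        _ = N ^ r₀ * N ^ (r.toReal - r₀) := by rw [← Finset.sum_mul, hNr]
        _ = N ^ r.toReal := by
            rw [← Real.rpow_add_of_nonneg hN0 hr₀.le (by linarith)]
            congr 1
            ring
    calc _ ≤ (N ^ r.toReal) ^ (1 / r.toReal) := Real.rpow_le_rpow (by positivity) h1 (by positivity)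
      _ = N := by rw [← Real.rpow_mul hN0, mul_one_div_cancel hrpos.ne', Real.rpow_one]

theorem avgNorm_mono [Nonempty α] {p₀ : ℝ} (hp₀ : 0 < p₀) {p : ℝ≥0∞}
    (hp : ENNReal.ofReal p₀ ≤ p) (f : α → ℂ) :
    avgNorm (ENNReal.ofReal p₀) f ≤ avgNorm p f := by
  have hc : (0 : ℝ) < Fintype.card α := by exact_mod_cast Fintype.card_pos
  rw [avgNorm_ofReal hp₀.le, avgNorm]
  split_ifs with h
  · have hpt : ∀ x, ‖f x‖ ≤ ⨆ x, ‖f x‖ := fun x =>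
      le_ciSup (f := fun x => ‖f x‖) (Set.finite_range _).bddAbove x
    have hS : 0 ≤ ⨆ x, ‖f x‖ := Real.iSup_nonneg fun _ => norm_nonneg _
    calc _ ≤ ((Fintype.card α : ℝ)⁻¹ * ∑ _x : α, (⨆ x, ‖f x‖) ^ p₀) ^ (1 / p₀) := by
          gcongr with x _
          exact hpt x
      _ = _ := by
          rw [Finset.sum_const, nsmul_eq_mul, Finset.card_univ, inv_mul_cancel_left₀ hc.ne',
            ← Real.rpow_mul hS, mul_one_div_cancel hp₀.ne', Real.rpow_one]
  · have hp1 : p₀ ≤ p.toReal := (ENNReal.ofReal_le_iff_le_toReal h).mp hp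
    have hppos : 0 < p.toReal := by linarith
    have h1 := sum_le_card_rpow_mul Finset.univ (fun x => ‖f x‖ ^ p₀) (fun _ _ => by positivity)
      (p := p.toReal / p₀) ((one_le_div hp₀).mpr hp1)
    have h2 : ∀ x, (‖f x‖ ^ p₀) ^ (p.toReal / p₀) = ‖f x‖ ^ p.toReal := by
      intro x
      rw [← Real.rpow_mul (norm_nonneg _), mul_div_cancel₀ _ hp₀.ne']
    simp_rw [h2, one_div_div, Finset.card_univ] at h1
    set S := ∑ x, ‖f x‖ ^ p.toReal
    have hS : 0 ≤ S := by positivity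
    calc _ ≤ ((Fintype.card α : ℝ)⁻¹ * ((Fintype.card α : ℝ) ^ (1 - p₀ / p.toReal)
          * S ^ (p₀ / p.toReal))) ^ (1 / p₀) := by gcongr
      _ = (((Fintype.card α : ℝ)⁻¹ * S) ^ (p₀ / p.toReal)) ^ (1 / p₀) := by
          congr 1
          rw [Real.mul_rpow (by positivity) hS, ← mul_assoc]
          congr 1
          rw [Real.rpow_sub hc, Real.rpow_one, Real.inv_rpow hc.le]
          field_simp
      _ = _ := by
          rw [← Real.rpow_mul (by positivity)]
          congr 1
          field_simp

end Norms

/-! ### Transfer to the extension operator. -/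

section Paraboloid

variable {F : Type*} [Field F] [Fintype F] {d : ℕ} {χ : AddChar F ℂ}

/-- The parametrization `y ↦ (y, y ⬝ᵥ y)` of the paraboloid. -/
def paraboloidEquiv (F : Type*) [Field F] [Fintype F] (d : ℕ) :
    (Fin (d - 1) → F) ≃ paraboloid F d where
  toFun y := ⟨(y, y ⬝ᵥ y), by simp [paraboloid]⟩
  invFun x := x.1.1
  left_inv _ := rfl
  right_inv x := by
    have := x.2
    simp only [paraboloid, Finset.mem_filter, Finset.mem_univ, true_and] at this
    exact Subtype.ext (Prod.ext rfl this.symm)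

theorem card_paraboloid : Fintype.card (paraboloid F d) = Fintype.card F ^ (d - 1) := by
  rw [← Fintype.card_congr (paraboloidEquiv F d)]
  simp

theorem norm_extension_eq (f : paraboloid F d → ℂ) (m : Space F d) :
    ‖extension χ (paraboloid F d) f m‖
      = ((Fintype.card F : ℝ) ^ (d - 1))⁻¹
        * ‖liftTransform χ (fun y => f (paraboloidEquiv F d y)) m‖ := by
  have h1 : (paraboloid F d).card = Fintype.card F ^ (d - 1) := by
    rw [← card_paraboloid, Fintype.card_coe]
  rw [extension, norm_mul, norm_inv, Complex.norm_natCast, h1, liftTransform,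
    ← Equiv.sum_comp (paraboloidEquiv F d)]
  push_cast
  rfl

theorem countNorm_extension_eq {r : ℝ} (hr : 0 < r) (f : paraboloid F d → ℂ) :
    countNorm (ENNReal.ofReal r) (extension χ (paraboloid F d) f)
      = ((Fintype.card F : ℝ) ^ (d - 1))⁻¹
        * (∑ m, ‖liftTransform χ (fun y => f (paraboloidEquiv F d y)) m‖ ^ r) ^ (1 / r) := by
  rw [countNorm_ofReal hr.le]
  simp_rw [norm_extension_eq]
  have h0 : 0 ≤ ((Fintype.card F : ℝ) ^ (d - 1))⁻¹ := by positivity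
  simp_rw [Real.mul_rpow h0 (norm_nonneg _)]
  rw [← Finset.mul_sum, Real.mul_rpow (by positivity) (by positivity), ← Real.rpow_mul h0,
    mul_one_div_cancel hr.ne', Real.rpow_one]

theorem avgNorm_paraboloid_eq {p : ℝ} (hp : 0 < p) (f : paraboloid F d → ℂ) :
    avgNorm (ENNReal.ofReal p) f
      = (((Fintype.card F : ℝ) ^ (d - 1))⁻¹
        * ∑ y, ‖f (paraboloidEquiv F d y)‖ ^ p) ^ (1 / p) := by
  rw [avgNorm_ofReal hp.le, card_paraboloid, ← Equiv.sum_comp (paraboloidEquiv F d)]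
  push_cast
  rfl

theorem extensionConstant_le {p r : ℝ≥0∞} {C : ℝ} (hC : 0 ≤ C)
    (h : ∀ f : paraboloid F d → ℂ,
      countNorm r (extension χ (paraboloid F d) f) ≤ C * avgNorm p f) :
    extensionConstant χ d p r ≤ C :=
  csInf_le ⟨0, fun _ hx => hx.1⟩ ⟨hC, h⟩

theorem extensionConstant_four_le {k K : ℕ} (hk : Odd k) (hk3 : 3 ≤ k) (hd : d = 2 * k + 1)
    (hχ : χ ≠ 1) (hs : ¬ IsSquare (-1 : F)) (hK : Fintype.card F ^ d ≤ 2 ^ K) {p : ℝ≥0∞}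
    (hp : ENNReal.ofReal (4 * (d : ℝ) / (3 * d - 2)) ≤ p) :
    extensionConstant χ d p 4 ≤ 2 * (2 * K + 1) := by
  have hd7 : (7 : ℝ) ≤ d := by exact_mod_cast (by omega : 7 ≤ d)
  have hdn : (d : ℝ) = ((d - 1 : ℕ) : ℝ) + 1 := by
    rw [Nat.cast_sub (by omega)]; simp
  have hq0 : (0 : ℝ) < Fintype.card F := by exact_mod_cast Fintype.card_pos
  have h32 : 0 < 3 * (d : ℝ) - 2 := by linarith
  have hp0 : 0 < 4 * (d : ℝ) / (3 * d - 2) := by positivity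
  have : Nonempty (paraboloid F d) := ⟨paraboloidEquiv F d 0⟩
  refine extensionConstant_le (by positivity) fun f => ?_
  refine le_trans ?_ (mul_le_mul_of_nonneg_left (avgNorm_mono hp0 hp f) (by positivity))
  have h4 := countNorm_extension_eq (χ := χ) (r := 4) (by norm_num) f
  rw [show ENNReal.ofReal 4 = 4 by simp] at h4
  have hst := liftTransform_strong_type hk hk3 (n := d - 1) (by omega) hχ hs hdn (K := K)
    (by rwa [Nat.sub_add_cancel (by omega)]) (fun y => f (paraboloidEquiv F d y))
  have hpe : 4 * (d : ℝ) / (3 * d - 2) = 1 / (3 / 4 - 1 / (2 * d)) := by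
    have : 3 / 4 - 1 / (2 * (d : ℝ)) = (3 * d - 2) / (4 * d) := by
      field_simp; ring
    rw [this, one_div_div]
  rw [h4, avgNorm_paraboloid_eq hp0, hpe, one_div_one_div]
  set s : ℝ := 3 / 4 - 1 / (2 * d) with hsdef
  set q : ℝ := (Fintype.card F : ℝ)
  set Y := ∑ y, ‖f (paraboloidEquiv F d y)‖ ^ (1 / s)
  have hY : 0 ≤ Y := by positivity
  have hqn : (q ^ (d - 1))⁻¹ = q ^ (1 - (d : ℝ)) := by
    rw [← Real.rpow_natCast, ← Real.rpow_neg hq0.le]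
    congr 1
    linarith
  rw [hqn, Real.mul_rpow (by positivity) hY, ← Real.rpow_mul hq0.le]
  calc _ ≤ q ^ (1 - (d : ℝ)) * (2 * q ^ ((d : ℝ) / 4 + 1 / 4 - 1 / (2 * d)) * (2 * K + 1) * Y ^ s) := by
        gcongr
    _ = 2 * (2 * K + 1) * (q ^ (1 - (d : ℝ)) * q ^ ((d : ℝ) / 4 + 1 / 4 - 1 / (2 * d)) * Y ^ s) := by
        ring
    _ = _ := by
        -- The powers of q from the normalizations and from the L^4 estimate cancel exactly, so only
        -- the logarithmic factor survives.
        rw [← Real.rpow_add hq0]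
        congr 3
        rw [hsdef]
        field_simp
        ring

/-- The dual exponent satisfies 1 - 1/r₀ = 1/2 + 1/d - 1/d², half the power of |G| in the
restriction bound, so duality lands exactly at the endpoint r₀. -/
theorem extensionConstant_two_le {k K : ℕ} (hk : Odd k) (hk3 : 3 ≤ k) (hd : d = 2 * k + 1)
    (hχ : χ ≠ 1) (hs : ¬ IsSquare (-1 : F)) (hK : Fintype.card F ^ d ≤ 2 ^ K) {r : ℝ≥0∞}
    (hr : ENNReal.ofReal (2 * (d : ℝ) ^ 2 / ((d : ℝ) ^ 2 - 2 * d + 2)) ≤ r) :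
    extensionConstant χ d 2 r ≤ 2 * (2 * K + 1) := by
  have hd7 : (7 : ℝ) ≤ d := by exact_mod_cast (by omega : 7 ≤ d)
  have hdn : (d : ℝ) = ((d - 1 : ℕ) : ℝ) + 1 := by
    rw [Nat.cast_sub (by omega)]; simp
  have hq0 : (0 : ℝ) < Fintype.card F := by exact_mod_cast Fintype.card_pos
  have hden : 0 < (d : ℝ) ^ 2 - 2 * d + 2 := by nlinarith
  set r₀ : ℝ := 2 * (d : ℝ) ^ 2 / ((d : ℝ) ^ 2 - 2 * d + 2) with hr₀
  have hr2 : 2 < r₀ := by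
    rw [hr₀, lt_div_iff₀ hden]
    nlinarith
  have hr0 : 0 < r₀ := by linarith
  have hsr : 1 - 1 / r₀ = 1 / 2 + 1 / (d : ℝ) - 1 / (d : ℝ) ^ 2 := by
    rw [hr₀, one_div_div]
    field_simp
    ring
  have hinv : 1 / r₀ < 1 / 2 := one_div_lt_one_div_of_lt (by norm_num) hr2
  have hinv0 : 0 < 1 / r₀ := by positivity
  refine extensionConstant_le (by positivity) fun f => ?_
  refine (countNorm_antitone hr0 hr _).trans ?_
  rw [countNorm_extension_eq hr0, show (2 : ℝ≥0∞) = ENNReal.ofReal 2 by simp,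
    avgNorm_paraboloid_eq (by norm_num)]
  have hD := liftTransform_le_of_restrictTransform_le hr2 (fun g =>
    restrictTransform_strong_type hk hk3 (n := d - 1) (by omega) hχ hs hdn (K := K)
      (by rwa [Nat.sub_add_cancel (by omega)]) hsr (by linarith) (by linarith) g)
      (fun y => f (paraboloidEquiv F d y))
  simp_rw [Real.rpow_two]
  rw [← Real.sqrt_eq_rpow, Real.sqrt_mul (by positivity), Real.sqrt_inv]
  set Q : ℝ := (Fintype.card F : ℝ) ^ (d - 1) with hQ
  have hQ0 : 0 < Q := by positivity
  set Y := ∑ y, ‖f (paraboloidEquiv F d y)‖ ^ 2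
  calc _ ≤ Q⁻¹ * (2 * √Q * (2 * K + 1) * √Y) := by gcongr
    _ = 2 * (2 * K + 1) * ((√Q / Q) * √Y) := by ring
    _ = _ := by rw [Real.sqrt_div_self]

end Paraboloid

theorem not_isSquare_neg_one_of_card {F : Type*} [Field F] [Fintype F] {p l : ℕ}
    (hp : p % 4 = 3) (hl : Odd l) (hF : Fintype.card F = p ^ l) : ¬ IsSquare (-1 : F) := by
  rw [FiniteField.isSquare_neg_one_iff, not_not, hF]
  obtain ⟨j, rfl⟩ := hl
  rw [pow_succ, pow_mul, Nat.mul_mod, Nat.pow_mod, Nat.pow_mod p 2, hp]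
  norm_num

/-- The logarithmic loss of the dyadic decomposition is absorbed by any power of `q`. -/
theorem exists_dyadic_bound (d : ℕ) {ε : ℝ} (hε : 0 < ε) {q : ℕ} (hq : 1 ≤ q) :
    ∃ K : ℕ, q ^ d ≤ 2 ^ K ∧
      2 * (2 * (K : ℝ) + 1) ≤ (4 * d / (ε * Real.log 2) + 6) * (q : ℝ) ^ ε := by
  have hq1 : (1 : ℝ) ≤ q := by exact_mod_cast hq
  have hlog2 : 0 < Real.log 2 := Real.log_pos (by norm_num)
  have hlogq : 0 ≤ Real.log q := Real.log_nonneg hq1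
  -- K is the base-2 logarithm of q^d rounded up; rounding costs at most 1, so 4K + 2 is at most
  -- four times that logarithm plus 6.
  refine ⟨⌈d * Real.log q / Real.log 2⌉₊, ?_, ?_⟩
  · have h1 : (d : ℝ) * Real.log q ≤ ⌈d * Real.log q / Real.log 2⌉₊ * Real.log 2 :=
      (div_le_iff₀ hlog2).mp (Nat.le_ceil _)
    generalize ⌈d * Real.log q / Real.log 2⌉₊ = K at h1 ⊢
    rw [← Real.log_pow, ← Real.log_pow, Real.log_le_log_iff (by positivity) (by positivity)] at h1
    exact_mod_cast h1
  · have h1 := (Nat.ceil_lt_add_one (a := d * Real.log q / Real.log 2) (by positivity)).le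
    have h2 : Real.log q ≤ (q : ℝ) ^ ε / ε := Real.log_le_rpow_div (by linarith) hε
    have h3 : 1 ≤ (q : ℝ) ^ ε := Real.one_le_rpow hq1 hε.le
    have h4 : d * Real.log q / Real.log 2 ≤ d * ((q : ℝ) ^ ε / ε) / Real.log 2 := by gcongr
    have h5 : 4 * (d * ((q : ℝ) ^ ε / ε) / Real.log 2) = 4 * d / (ε * Real.log 2) * (q : ℝ) ^ ε := by
      field_simp
    rw [add_mul]
    linarith

end Extension
end

theorem theorem2p3 (d : ℕ) (hd : 7 ≤ d) (hodd : Odd d) (ε : ℝ) (hε : 0 < ε) :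
    ∃ C : ℝ, 0 < C ∧
      ∀ (F : Type*) [Field F] [Fintype F] (π l : ℕ),
        π.Prime → π % 4 = 3 → Fintype.card F = π ^ l → ¬ 4 ∣ l * (d - 1) →
        ∀ χ : AddChar F ℂ, χ ≠ 1 →
          (∀ p : ℝ≥0∞, ENNReal.ofReal (4 * (d : ℝ) / (3 * d - 2)) ≤ p →
            Extension.extensionConstant χ d p 4 ≤ C * (Fintype.card F : ℝ) ^ ε) ∧
          (∀ r : ℝ≥0∞, ENNReal.ofReal (2 * (d : ℝ) ^ 2 / ((d : ℝ) ^ 2 - 2 * d + 2)) ≤ r →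
            Extension.extensionConstant χ d 2 r ≤ C * (Fintype.card F : ℝ) ^ ε) := by
  have hlog2 : 0 < Real.log 2 := Real.log_pos (by norm_num)
  refine ⟨4 * d / (ε * Real.log 2) + 6, by positivity, ?_⟩
  intro F _ _ π l _ hπ4 hF h4 χ hχ
  obtain ⟨k, hk⟩ := hodd
  have hdk : d - 1 = 2 * k := by omega
  rw [hdk] at h4
  -- Since d - 1 = 2k, an even l or an even k would make l(d - 1) divisible by 4. Odd l makes -1 a
  -- nonsquare; odd k makes (-q)^k negative.
  have hl : Odd l := by
    by_contra hl
    obtain ⟨j, hj⟩ := Nat.not_odd_iff_even.mp hl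
    exact h4 ⟨j * k, by rw [hj]; ring⟩
  have hko : Odd k := by
    by_contra hko
    obtain ⟨j, hj⟩ := Nat.not_odd_iff_even.mp hko
    exact h4 ⟨l * j, by rw [hj]; ring⟩
  have hs : ¬ IsSquare (-1 : F) := Extension.not_isSquare_neg_one_of_card hπ4 hl hF
  obtain ⟨K, hK, hKC⟩ := Extension.exists_dyadic_bound d hε (q := Fintype.card F) Fintype.card_pos
  exact ⟨fun p hp => (Extension.extensionConstant_four_le hko (by omega) hk hχ hs hK hp).trans hKC,
    fun r hr => (Extension.extensionConstant_two_le hko (by omega) hk hχ hs hK hr).trans hKC⟩
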